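/- Let $X$ be a connected compact complex manifold of dimension $m>0$ with a smooth Kähler form $\omega_0$, let $g:X\to X$ be a holomorphic isometry (that is, $g$ is holomorphic and $g^*\omega_0=\omega_0$) with $g\circ g=\mathrm{id}_X$, and let $x_0$ be an isolated fixed point of $g$. Let $z_1,\dots,z_m$ be holomorphic local coordinates on an open neighborhood $V$ of $x_0$ with $g(V)\subset V$, in which $g$ is expressed as $(z_j)\mapsto(-z_j)$. Put $S=\{s\in\mathbb C:0<\operatorname{Im}s<1\}$ and $\overline S=\{s\in\mathbb C:0\le\operatorname{Im}s\le1\}$, and let $\omega$ be the pullback of $\omega_0$ by the projection $\overline S\times X\to X$. A continuous function $u:\overline S\times V\to\mathbb R$ belongs to $C^{\partial\bar\partial}(\overline S\times V)$ if the current $\partial\bar\partial(u|_{S\times V})$ is represented by a form that is continuous on $\overline S\times V$; that form is again denoted $\partial\bar\partial u$. Such a $u$ is $\omega$-plurisubharmonic if $\omega+i\partial\bar\partial u\ge0$ on $\overline S\times V$. Proposition 3.1. Let $v$ be a real function on $X$ and suppose that an $\omega$-plurisubharmonic $u\in C^{\partial\bar\partial}(\overline S\times V)$ solves $$(\omega+i\partial\bar\partial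 u)^{m+1}=0\ \text{ on }\overline S\times V,\qquad u(s+\sigma,x)=u(s,x)\ \text{ for }(s,x)\in\overline S\times V,\ \sigma\in\mathbb R,\tag{1.1}$$ $$u(s,x)=0\ \text{ if }\operatorname{Im}s=0,\qquad u(s,x)=v(x)\ \text{ if }\operatorname{Im}s=1\qquad(x\in V),$$ and that $u(s,g(x))=u(s,x)$ for all $(s,x)\in\overline S\times V$. Then there is an $a\in\mathbb R$ such that $u(s,x_0)=a\operatorname{Im}s$ for all $s\in\overline S$. -/

import Mathlib

open MeasureTheory Complex
open scoped Manifold ContDiff ComplexOrder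

noncomputable section

namespace WeakGeodesic

/-- The open strip `S = {0 < Im s < 1}`. -/
def strip : Set ℂ := {s | 0 < s.im ∧ s.im < 1}

/-- Its closure, a Riemann surface with boundary. -/
def closedStrip : Set ℂ := {s | 0 ≤ s.im ∧ s.im ≤ 1}

/-! ### Forms on complex manifolds -/

section Manifold

variable {m : ℕ} {X : Type*} [TopologicalSpace X] [ChartedSpace (Fin m → ℂ) X]

/-- A (not necessarily smooth) real two-form on the complex manifold `X`. -/
abbrev TwoForm (m : ℕ) (X : Type*) [TopologicalSpace X] [ChartedSpace (Fin m → ℂ) X] : Type _ :=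
  ∀ x : X, TangentSpace 𝓘(ℂ, Fin m → ℂ) x [⋀^Fin 2]→L[ℝ] ℝ

/-- A two-form written in a chart `e`: the pullback of `α` by `e.symm`. It is
meaningful on `e.target`. -/
def chartForm (α : TwoForm m X) (e : OpenPartialHomeomorph X (Fin m → ℂ))
    (y : Fin m → ℂ) : (Fin m → ℂ) [⋀^Fin 2]→L[ℝ] ℝ :=
  (α (e.symm y)).compContinuousLinearMap
    ((mfderiv 𝓘(ℂ, Fin m → ℂ) 𝓘(ℂ, Fin m → ℂ) e.symm y).restrictScalars ℝ)

/-- Smooth Kähler forms: smooth, closed, positive real forms of type `(1,1)`.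
Smoothness and closedness are read in the holomorphic charts. -/
structure IsKaehlerForm (α : TwoForm m X) : Prop where
  type_one_one : ∀ (x : X) (ξ η : TangentSpace 𝓘(ℂ, Fin m → ℂ) x),
    α x ![I • ξ, I • η] = α x ![ξ, η]
  pos : ∀ (x : X) (ξ : TangentSpace 𝓘(ℂ, Fin m → ℂ) x), ξ ≠ 0 → 0 < α x ![ξ, I • ξ]
  smooth : ∀ e ∈ IsManifold.maximalAtlas 𝓘(ℂ, Fin m → ℂ) ω X,
    ContDiffOn ℝ ∞ (chartForm α e) e.target
  closed : ∀ e ∈ IsManifold.maximalAtlas 𝓘(ℂ, Fin m → ℂ) ω X,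
    ∀ y ∈ e.target, extDeriv (chartForm α e) y = 0

/-- `g` is a holomorphic isometry of `X` with respect to the Kähler form `α`:
it is holomorphic and `g^* α = α`. -/
structure IsHolomorphicIsometry (α : TwoForm m X) (g : X → X) : Prop where
  holomorphic : ContMDiff 𝓘(ℂ, Fin m → ℂ) 𝓘(ℂ, Fin m → ℂ) ω g
  pullback_eq : ∀ x : X,
    (α (g x)).compContinuousLinearMap
      ((mfderiv 𝓘(ℂ, Fin m → ℂ) 𝓘(ℂ, Fin m → ℂ) g x).restrictScalars ℝ) = α x

end Manifold

/-- The coefficients `h j k` of a real alternating form `α` of type `(1,1)` on `ℂ^m`, in the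
normalization `α = i ∑ h j k dz_j ∧ d\bar z_k`. -/
def hermCoeff {m : ℕ} (α : (Fin m → ℂ) [⋀^Fin 2]→L[ℝ] ℝ) : Matrix (Fin m) (Fin m) ℂ :=
  fun j k =>
    ((α ![Pi.single j 1, Pi.single k I] : ℂ) - I * (α ![Pi.single j 1, Pi.single k 1] : ℂ)) / 2

/-! ### Calculus on `ℂ × ℂ^m`, with coordinates `ζ = (s, z_1, …, z_m)` -/

/-- Index set of the coordinates: `Sum.inl ()` for `s` and `Sum.inr j` for `z_j`. -/
abbrev Idx (m : ℕ) : Type := Unit ⊕ Fin m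

/-- The vector of `ℂ × ℂ^m` with `p`-th coordinate `c` and the other coordinates `0`. -/
def coordVec {m : ℕ} (p : Idx m) (c : ℂ) : ℂ × (Fin m → ℂ) :=
  Sum.elim (fun _ => (c, 0)) (fun j => (0, Pi.single j c)) p

/-- The Wirtinger derivative `∂f/∂ζ_p`. -/
def wirtinger {m : ℕ} (p : Idx m) (f : ℂ × (Fin m → ℂ) → ℂ) (y : ℂ × (Fin m → ℂ)) : ℂ :=
  (fderiv ℝ f y (coordVec p 1) - I * fderiv ℝ f y (coordVec p I)) / 2

/-- The Wirtinger derivative `∂f/∂\bar ζ_p`. -/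
def wirtingerBar {m : ℕ} (p : Idx m) (f : ℂ × (Fin m → ℂ) → ℂ) (y : ℂ × (Fin m → ℂ)) : ℂ :=
  (fderiv ℝ f y (coordVec p 1) + I * fderiv ℝ f y (coordVec p I)) / 2

/-- `w` is of class `C^{∂\bar∂}` on `A` (a manifold with boundary in `ℂ × ℂ^m`), and `c` is the
matrix of coefficients of the continuous form `∂\bar∂w = ∑ c p q dζ_p ∧ d\bar ζ_q`: both `w` and
`c` are continuous on `A`, and `∂²w/∂ζ_p∂\bar ζ_q = c p q` in the sense of distributions on the
interior of `A`. -/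
structure HasDdbar {m : ℕ} (w : ℂ × (Fin m → ℂ) → ℝ)
    (c : ℂ × (Fin m → ℂ) → Matrix (Idx m) (Idx m) ℂ) (A : Set (ℂ × (Fin m → ℂ))) : Prop where
  continuousOn : ContinuousOn w A
  continuousOn_coeff : ContinuousOn c A
  weak : ∀ χ : ℂ × (Fin m → ℂ) → ℂ, ContDiff ℝ ∞ χ → HasCompactSupport χ →
    tsupport χ ⊆ interior A → ∀ p q : Idx m,
      ∫ y, (w y : ℂ) * wirtinger p (wirtingerBar q χ) y = ∫ y, c y p q * χ y

/-- The covector `dζ_p`, an `ℝ`-linear map to `ℂ`. -/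
def dcoord {m : ℕ} (p : Idx m) : (ℂ × (Fin m → ℂ)) →ₗ[ℝ] ℂ :=
  Sum.elim (fun _ => LinearMap.fst ℝ ℂ (Fin m → ℂ))
    (fun j => (LinearMap.proj j).comp (LinearMap.snd ℝ ℂ (Fin m → ℂ))) p

/-- The covector `d\bar ζ_p`. -/
def dcoordBar {m : ℕ} (p : Idx m) : (ℂ × (Fin m → ℂ)) →ₗ[ℝ] ℂ :=
  conjAe.toLinearMap.comp (dcoord p)

/-- The form `i ∑ h p q dζ_p ∧ d\bar ζ_q`, in the exterior algebra of the complexified cotangent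
space of `ℂ × ℂ^m`. -/
def oneOneForm {m : ℕ} (h : Matrix (Idx m) (Idx m) ℂ) :
    ExteriorAlgebra ℂ ((ℂ × (Fin m → ℂ)) →ₗ[ℝ] ℂ) :=
  ∑ p, ∑ q, (I * h p q) •
    (ExteriorAlgebra.ι ℂ (dcoord (m := m) p) * ExteriorAlgebra.ι ℂ (dcoordBar (m := m) q))

/-! ### The boundary value problem -/

section Problem

variable {m : ℕ} {X : Type*} [TopologicalSpace X] [ChartedSpace (Fin m → ℂ) X]

/-- The coefficient matrix of `ω + i∂\bar∂u` at a point of `closedStrip × φ.target`, where `c` is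
the coefficient matrix of `∂\bar∂u` and `ω` is the pullback of `ω₀` by `(s, x) ↦ x`. -/
def totalCoeff (ω₀ : TwoForm m X) (φ : OpenPartialHomeomorph X (Fin m → ℂ))
    (c : ℂ × (Fin m → ℂ) → Matrix (Idx m) (Idx m) ℂ) (y : ℂ × (Fin m → ℂ)) :
    Matrix (Idx m) (Idx m) ℂ :=
  Matrix.fromBlocks 0 0 0 (hermCoeff (chartForm ω₀ φ y.2)) + c y

/-- With `V = φ.source` the domain of a holomorphic chart `φ` and `\bar S` the closed strip: `u` is
an `ω`-plurisubharmonic function of class `C^{∂\bar∂}` on `\bar S × V` that solves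
`(ω + i∂\bar∂u)^(m+1) = 0`, is invariant under real translations in `s`, and has boundary values
`0` on `Im s = 0` and `v` on `Im s = 1`. Only the values of `u` on `\bar S × V` matter. -/
structure IsPshSolution (ω₀ : TwoForm m X) (φ : OpenPartialHomeomorph X (Fin m → ℂ))
    (v : X → ℝ) (u : ℂ → X → ℝ) : Prop where
  exists_ddbar : ∃ c : ℂ × (Fin m → ℂ) → Matrix (Idx m) (Idx m) ℂ,
    HasDdbar (fun y => u y.1 (φ.symm y.2)) c (closedStrip ×ˢ φ.target) ∧
    ∀ y ∈ closedStrip ×ˢ φ.target,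
      (totalCoeff ω₀ φ c y).PosSemidef ∧ oneOneForm (totalCoeff ω₀ φ c y) ^ (m + 1) = 0
  translation : ∀ s ∈ closedStrip, ∀ x ∈ φ.source, ∀ σ : ℝ, u (s + σ) x = u s x
  boundary_zero : ∀ s : ℂ, s.im = 0 → ∀ x ∈ φ.source, u s x = 0
  boundary_one : ∀ s : ℂ, s.im = 1 → ∀ x ∈ φ.source, u s x = v x

end Problem

end WeakGeodesic

end

namespace WeakGeodesic

/-! Work in the chart, where $x_0$ is $z=0$, and study $w(s,z)=u(s,x)$ along the axis $s=it$, $z=0$.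
Since $w$ is even in $z$, the mixed coefficients $\partial^2w/\partial s\,\partial\bar z_j$ vanish
on the axis (`HasDdbar.coeff_eq_zero_of_even`). The equation says that the coefficient matrix of
$\omega+i\partial\bar\partial u$ has determinant zero (`det_eq_zero_of_oneOneForm_pow_eq_zero`). On
the axis this determinant is the product of $w_{s\bar s}$ and the determinant $D(t)$ of the fiber
block. Where $D\ne0$, therefore, $w_{s\bar s}=0$: the axis is a leaf, and translation invariance
makes $w$ affine in $t$ there. It remains to show that $D$ never vanishes.

At $t=0$ the boundary value is $0$, so the fiber block is that of $\omega_0$, which is positive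
(`HasDdbar.levi_eq_zero_of_boundary`). Let $T$ be the first zero of $D$ and $a\neq 0$ a null
direction there. Let $h(t)$ be the fiber Levi form of $\omega+i\partial\bar\partial u$ at $(it,0)$
in direction $a$; thus $h(0)>0$ and $h(T)=0$. The contradiction comes from log-convexity of $h$ on
$(0,T)$, in the form: $h(t)e^{\lambda t}$ is convex for every real $\lambda$
(`HasDdbar.convexOn_levi_mul_exp`). Letting $\lambda\to\infty$ forces $h\le0$ on $(0,T)$, hence
$h(0)\le0$ (`nonpos_of_convexOn_mul_exp`).

Log-convexity uses circular means. If $w+K|\zeta|^2$ is plurisubharmonic on the surface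
$(s,\zeta)\mapsto(s,\zeta a)$, its mean over $|\zeta|=e^\tau$, $s=it$, is invariant under real
translations of $s$ and of $\operatorname{Im}\log\zeta$, so it is convex in $(t,\tau)$
(`HasDdbar.convexOn_circleMean`). Subtracting the axis value, affine in $t$, keeps convexity. As
$\tau\to-\infty$ the difference behaves like $2\pi e^{2\tau}$ times $K$ plus the Levi form of $w$ in
direction $a$ (`HasDdbar.tendsto_circleMean_sub`). Restricting to lines of slope $\lambda/2$,
dividing by the common exponential and letting $K$ decrease to the value of the $\omega_0$-term at
$x_0$ gives the claim.

Since $w$ has only a weak continuous $\partial\bar\partial$, convexity is proved for mollifications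
and passed to the limit. -/

/-! ### Exterior algebra: the Monge–Ampère equation as a vanishing determinant. -/

theorem add_pow_succ_of_sq_zero {A : Type*} [Ring A] {a b : A} (hab : Commute a b)
    (ha : a * a = 0) (k : ℕ) : (a + b) ^ (k + 1) = b ^ (k + 1) + (k + 1) • (a * b ^ k) := by
  induction k with
  | zero => simp [add_comm]
  | succ k ih =>
    have h1 : a * b ^ k * a = 0 := by
      rw [mul_assoc, ← (hab.pow_right k).eq, ← mul_assoc, ha, zero_mul]
    have h2 : b ^ (k + 1) * a = a * b ^ (k + 1) := ((hab.pow_right (k + 1)).eq).symm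
    rw [pow_succ, ih, add_mul, mul_add, mul_add, smul_mul_assoc, smul_mul_assoc, h1, h2,
      mul_assoc a, ← pow_succ, ← pow_succ, smul_zero, zero_add, succ_nsmul _ (k + 1)]
    abel

/-- Multinomial expansion: only the square-free monomial survives in degree $n$, and it arises in
$n!$ orders. The vanishing in degree $n+1$ is carried along because the induction step needs it. -/
theorem sum_pow_of_sq_zero {A : Type*} [Ring A] (n : ℕ) (x : Fin n → A)
    (hc : ∀ i j, Commute (x i) (x j)) (hsq : ∀ i, x i * x i = 0) :
    (∑ i, x i) ^ n = n.factorial • (List.ofFn x).prod ∧ (∑ i, x i) ^ (n + 1) = 0 := by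
  induction n with
  | zero => simp
  | succ n ih =>
    obtain ⟨h1, h2⟩ := ih (fun i => x i.succ) (fun i j => hc _ _) (fun i => hsq _)
    have hcomm : Commute (x 0) (∑ i : Fin n, x i.succ) :=
      Commute.sum_right _ _ _ fun i _ => hc _ _
    rw [Fin.sum_univ_succ]
    refine ⟨?_, ?_⟩
    · rw [add_pow_succ_of_sq_zero hcomm (hsq 0), h2, h1, zero_add, List.ofFn_succ, List.prod_cons,
        mul_smul_comm, smul_smul, Nat.factorial_succ]
    · rw [add_pow_succ_of_sq_zero hcomm (hsq 0), pow_succ, h2]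
      simp

theorem ιMulti_ne_zero {E : Type*} [AddCommGroup E] [Module ℂ E] {n : ℕ} {v : Fin n → E}
    (hv : LinearIndependent ℂ v) : ExteriorAlgebra.ιMulti ℂ n v ≠ 0 := by
  have h := exteriorPower.ιMulti_family_linearIndependent_field n hv
  have h1 := h.ne_zero (Set.powersetCard.ofFinEmbEquiv (RelEmbedding.refl (· ≤ ·)))
  intro h0
  apply h1
  ext
  rw [exteriorPower.ιMulti_family_apply_coe, ExteriorAlgebra.ιMulti_family,
    Equiv.symm_apply_apply]
  exact h0

theorem prod_pairs_ne_zero {E : Type*} [AddCommGroup E] [Module ℂ E] {n : ℕ} {a b : Fin n → E}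
    (hv : LinearIndependent ℂ (fun i : Fin n × Fin 2 => if i.2 = 0 then a i.1 else b i.1)) :
    (List.ofFn fun i => ExteriorAlgebra.ι ℂ (a i) * ExteriorAlgebra.ι ℂ (b i)).prod ≠ 0 := by
  have h := ιMulti_ne_zero (hv.comp (finProdFinEquiv (m := n) (n := 2)).symm (Equiv.injective _))
  rw [ExteriorAlgebra.ιMulti_apply, List.ofFn_mul, List.prod_flatten, List.map_ofFn] at h
  convert h using 4 with i
  have h0 : finProdFinEquiv.symm (⟨(i : ℕ) * 2 + (0 : Fin 2), by simp⟩ : Fin (n * 2))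
      = (i, 0) := by
    rw [Equiv.symm_apply_eq]; ext; simp [mul_comm]
  have h1 : finProdFinEquiv.symm (⟨(i : ℕ) * 2 + (1 : Fin 2), by simp; omega⟩ : Fin (n * 2))
      = (i, 1) := by
    rw [Equiv.symm_apply_eq]; ext; simp [mul_comm, add_comm]
  simp only [Function.comp_apply, List.ofFn_succ, List.ofFn_zero, List.prod_cons, List.prod_nil,
    mul_one, Fin.succ_zero_eq_one, h0, h1]
  simp

@[simp] theorem dcoord_coordVec {m : ℕ} (p q : Idx m) (z : ℂ) :
    dcoord p (coordVec q z) = if p = q then z else 0 := by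
  rcases p with p | p <;> rcases q with q | q <;> simp [dcoord, coordVec, Pi.single_apply]

/-- The $d\zeta_p$ are complex linear and the $d\bar\zeta_q$ antilinear, so a relation splits into
two; invertibility of $h$ then removes the antilinear part. -/
theorem linearIndependent_coords {m : ℕ} {h : Matrix (Idx m) (Idx m) ℂ} (hdet : h.det ≠ 0) :
    LinearIndependent ℂ (fun i : Idx m × Fin 2 =>
      if i.2 = 0 then dcoord i.1 else ∑ q, (I * h i.1 q) • dcoordBar q) := by
  rw [Fintype.linearIndependent_iff]
  intro g hg
  -- Evaluating the relation on the $r$-th coordinate line gives $Az+B\bar z=0$ for all $z$; the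
  -- values $z=1$ and $z=i$ yield $A=B=0$.
  have key : ∀ (r : Idx m) (z : ℂ), g (r, 0) * z + (∑ p, g (p, 1) * (I * h p r)) * star z = 0 := by
    intro r z
    have := congrArg (fun L => L (coordVec r z)) hg
    simp only [Fintype.sum_prod_type, Fin.sum_univ_two, LinearMap.sum_apply, LinearMap.add_apply,
      LinearMap.smul_apply, LinearMap.zero_apply, Finset.sum_add_distrib] at this
    simp [-Fintype.sum_sum_type, dcoordBar, apply_ite (starRingEnd ℂ)] at this
    simpa [-Fintype.sum_sum_type, Finset.sum_mul, mul_assoc] using this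
  have h1 : ∀ r, g (r, 0) = 0 ∧ ∑ p, g (p, 1) * (I * h p r) = 0 := by
    intro r
    have e1 := key r 1
    have e2 := key r I
    simp only [star_one, mul_one, RCLike.star_def, conj_I, mul_neg] at e1 e2
    have e3 : g (r, 0) - ∑ p, g (p, 1) * (I * h p r) = 0 := by
      apply mul_right_cancel₀ I_ne_zero
      linear_combination e2
    constructor
    · linear_combination (e1 + e3) / 2
    · linear_combination (e1 - e3) / 2
  have h2 : (fun p => g (p, 1)) = 0 := by
    apply Matrix.eq_zero_of_vecMul_eq_zero hdet
    ext r
    have := (h1 r).2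
    apply mul_left_cancel₀ I_ne_zero
    rw [Pi.zero_apply, mul_zero, ← this, Matrix.vecMul, dotProduct, Finset.mul_sum]
    exact Finset.sum_congr rfl fun p _ => by ring
  rintro ⟨p, j⟩
  fin_cases j
  · exact (h1 p).1
  · exact congrFun h2 p

/-- Grouping by $p$ writes the form as a sum of $m+1$ products $d\zeta_p\wedge\eta_p$, which commute
and square to zero. Its top power is $(m+1)!$ times their product, a wedge of $2(m+1)$ covectors
that are independent when $\det h\ne0$. -/
theorem det_eq_zero_of_oneOneForm_pow_eq_zero {m : ℕ} {h : Matrix (Idx m) (Idx m) ℂ}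
    (hh : oneOneForm h ^ (m + 1) = 0) : h.det = 0 := by
  by_contra hdet
  let e : Fin (m + 1) ≃ Idx m := Fintype.equivOfCardEq (by simp [add_comm])
  let a : Fin (m + 1) → ((ℂ × (Fin m → ℂ)) →ₗ[ℝ] ℂ) := fun i => dcoord (e i)
  let b : Fin (m + 1) → ((ℂ × (Fin m → ℂ)) →ₗ[ℝ] ℂ) :=
    fun i => ∑ q, (I * h (e i) q) • dcoordBar q
  have hsum : oneOneForm h
      = ∑ i, ExteriorAlgebra.ι ℂ (a i) * ExteriorAlgebra.ι ℂ (b i) := by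
    rw [oneOneForm, ← e.sum_comp]
    refine Finset.sum_congr rfl fun i _ => ?_
    simp only [a, b, map_sum, map_smul, Finset.mul_sum, mul_smul_comm]
  have hanti : ∀ x y : (ℂ × (Fin m → ℂ)) →ₗ[ℝ] ℂ, ExteriorAlgebra.ι ℂ x * ExteriorAlgebra.ι ℂ y
      = -(ExteriorAlgebra.ι ℂ y * ExteriorAlgebra.ι ℂ x) := fun x y =>
    eq_neg_of_add_eq_zero_left (ExteriorAlgebra.ι_add_mul_swap x y)
  have hcomm : ∀ i j, Commute (ExteriorAlgebra.ι ℂ (a i) * ExteriorAlgebra.ι ℂ (b i))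
      (ExteriorAlgebra.ι ℂ (a j) * ExteriorAlgebra.ι ℂ (b j)) := by
    intro i j
    have h4 : ∀ x y z : (ℂ × (Fin m → ℂ)) →ₗ[ℝ] ℂ,
        Commute (ExteriorAlgebra.ι ℂ x * ExteriorAlgebra.ι ℂ y) (ExteriorAlgebra.ι ℂ z) := by
      intro x y z
      change _ * _ = _ * _
      rw [mul_assoc, hanti y z, mul_neg, ← mul_assoc, hanti x z, neg_mul, neg_neg, mul_assoc]
    exact (h4 _ _ _).mul_right (h4 _ _ _)
  have hsq : ∀ i, (ExteriorAlgebra.ι ℂ (a i) * ExteriorAlgebra.ι ℂ (b i)) *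
      (ExteriorAlgebra.ι ℂ (a i) * ExteriorAlgebra.ι ℂ (b i)) = 0 := by
    intro i
    rw [mul_assoc, ← mul_assoc (ExteriorAlgebra.ι ℂ (b i)), hanti (b i), neg_mul, mul_assoc,
      ExteriorAlgebra.ι_sq_zero, mul_zero, neg_zero, mul_zero]
  have h1 := (sum_pow_of_sq_zero (m + 1) _ hcomm hsq).1
  rw [← hsum, hh] at h1
  have h2 := prod_pairs_ne_zero (a := a) (b := b)
    ((linearIndependent_coords hdet).comp (Prod.map e id)
      (e.injective.prodMap Function.injective_id))
  rw [← Nat.cast_smul_eq_nsmul ℂ] at h1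
  exact h2 ((smul_eq_zero.1 h1.symm).resolve_left (by exact_mod_cast Nat.factorial_ne_zero _))

/-! ### Circular means of smooth functions. -/

open Set Filter Topology

section Curves

variable {M : Type*} [NormedAddCommGroup M] [NormedSpace ℝ M]

theorem hasDerivAt_comp_curve {u : M → ℝ} (hu : ContDiff ℝ ∞ u) {P P' : ℝ → M} {x : ℝ}
    (hP : HasDerivAt P (P' x) x) :
    HasDerivAt (fun x => u (P x)) (fderiv ℝ u (P x) (P' x)) x :=
  ((hu.differentiable (by simp)) (P x)).hasFDerivAt.comp_hasDerivAt x hP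

theorem hasDerivAt_fderiv_comp_curve {u : M → ℝ} (hu : ContDiff ℝ ∞ u) {P P' : ℝ → M} {P'' : M}
    {x : ℝ} (hP : HasDerivAt P (P' x) x) (hP' : HasDerivAt P' P'' x) :
    HasDerivAt (fun x => fderiv ℝ u (P x) (P' x))
      (fderiv ℝ (fderiv ℝ u) (P x) (P' x) (P' x) + fderiv ℝ u (P x) P'') x := by
  have h1 : ContDiff ℝ ∞ (fderiv ℝ u) := hu.fderiv_right (by simp)
  have h2 := ((h1.differentiable (by simp)) (P x)).hasFDerivAt.comp_hasDerivAt x hP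
  exact h2.clm_apply hP'

end Curves

theorem hasDerivAt_integral_of_continuous {F F' : ℝ → ℝ → ℝ} {a b : ℝ}
    (hF : Continuous (Function.uncurry F)) (hF' : Continuous (Function.uncurry F'))
    (hd : ∀ x θ, HasDerivAt (fun x => F x θ) (F' x θ) x) (x : ℝ) :
    HasDerivAt (fun x => ∫ θ in a..b, F x θ) (∫ θ in a..b, F' x θ) x := by
  obtain ⟨C, hC⟩ := ((isCompact_Icc (a := x - 1) (b := x + 1)).prod
    (isCompact_uIcc (a := a) (b := b))).exists_bound_of_continuousOn hF'.continuousOn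
  have c1 : ∀ y, Continuous (F y) := fun y => hF.comp (Continuous.prodMk_right y)
  have c2 : ∀ y, Continuous (F' y) := fun y => hF'.comp (Continuous.prodMk_right y)
  refine (intervalIntegral.hasDerivAt_integral_of_dominated_loc_of_deriv_le (F := F) (F' := F')
    (bound := fun _ => C) (Icc_mem_nhds (by linarith : x - 1 < x) (by linarith : x < x + 1))
    (Eventually.of_forall fun y => (c1 y).aestronglyMeasurable)
    ((c1 x).intervalIntegrable _ _) (c2 x).aestronglyMeasurable
    (Eventually.of_forall fun θ hθ y hy => ?_) intervalIntegrable_const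
    (Eventually.of_forall fun θ hθ y hy => hd y θ)).2
  exact hC (y, θ) ⟨hy, uIoc_subset_uIcc hθ⟩

variable {m : ℕ}

/-- Four times the Levi form of `u` at `y`, in the direction `ξ`. -/
noncomputable def smoothLevi (u : ℂ × (Fin m → ℂ) → ℝ) (y ξ : ℂ × (Fin m → ℂ)) : ℝ :=
  fderiv ℝ (fderiv ℝ u) y ξ ξ + fderiv ℝ (fderiv ℝ u) y (I • ξ) (I • ξ)

/-- The point `(i t, exp (τ + i θ) a)`. -/
noncomputable def polarPoint (a : Fin m → ℂ) (t τ θ : ℝ) : ℂ × (Fin m → ℂ) :=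
  (I * t, exp (τ + I * θ) • a)

theorem continuous_polarPoint (a : Fin m → ℂ) :
    Continuous fun p : ℝ × ℝ × ℝ => polarPoint a p.1 p.2.1 p.2.2 := by
  unfold polarPoint
  fun_prop

/-- The gradient inherits the translation invariance, so its derivative in the direction $(1,0)$ is
that of a constant. -/
theorem fderiv_fderiv_apply_fst {u : ℂ × (Fin m → ℂ) → ℝ} 
    (hinv : ∀ (s : ℂ) (z : Fin m → ℂ) (σ : ℝ), u (s + σ, z) = u (s, z))
    (y : ℂ × (Fin m → ℂ)) : fderiv ℝ (fderiv ℝ u) y (1, 0) = 0 := by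
  by_cases hd : DifferentiableAt ℝ (fderiv ℝ u) y
  swap
  -- Where the gradient is not differentiable, `fderiv` takes its default value $0$.
  · rw [fderiv_zero_of_not_differentiableAt hd]; rfl
  have hfd : ∀ σ : ℝ, fderiv ℝ u (y + σ • (1, 0)) = fderiv ℝ u y := by
    intro σ
    have h1 : (fun y => u (y + σ • ((1 : ℂ), (0 : Fin m → ℂ)))) = u := by
      funext y
      have := hinv y.1 y.2 σ
      rw [← this]
      congr 1
      ext <;> simp
    conv_rhs => rw [← h1]
    rw [fderiv_comp_add_right]
  have h2 : HasDerivAt (fun σ : ℝ => y + σ • ((1 : ℂ), (0 : Fin m → ℂ))) (1, 0) 0 := by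
    simpa using ((hasDerivAt_id (0 : ℝ)).smul_const ((1 : ℂ), (0 : Fin m → ℂ))).const_add y
  have h3 : HasFDerivAt (fderiv ℝ u) (fderiv ℝ (fderiv ℝ u) y)
      (y + (0 : ℝ) • ((1 : ℂ), (0 : Fin m → ℂ))) := by simpa using hd.hasFDerivAt
  have h4 := h3.comp_hasDerivAt (0 : ℝ) h2
  have h5 : (fderiv ℝ u ∘ fun σ : ℝ => y + σ • ((1 : ℂ), (0 : Fin m → ℂ)))
      = fun _ => fderiv ℝ u y := funext hfd
  rw [h5] at h4
  exact h4.unique (hasDerivAt_const _ _)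

theorem fderiv_fderiv_apply_add_fst {u : ℂ × (Fin m → ℂ) → ℝ} (hu : ContDiff ℝ ∞ u)
    (hinv : ∀ (s : ℂ) (z : Fin m → ℂ) (σ : ℝ), u (s + σ, z) = u (s, z))
    (y ξ : ℂ × (Fin m → ℂ)) (α : ℝ) :
    fderiv ℝ (fderiv ℝ u) y (α • (1, 0) + ξ) (α • (1, 0) + ξ) = fderiv ℝ (fderiv ℝ u) y ξ ξ := by
  have h0 := fderiv_fderiv_apply_fst hinv y
  have hs : fderiv ℝ (fderiv ℝ u) y ξ (1, 0) = fderiv ℝ (fderiv ℝ u) y (1, 0) ξ :=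
    (hu.contDiffAt.isSymmSndFDerivAt (by
    simpa using WithTop.coe_le_coe.2 (le_top : (2 : ℕ∞) ≤ ⊤))) _ _
  simp only [map_add, map_smul, h0, hs, _root_.zero_apply, smul_zero, zero_add]

theorem hasDerivAt_exp_line (τ β : ℝ) (c : ℂ) (x : ℝ) :
    HasDerivAt (fun x : ℝ => exp (((τ + β * x : ℝ) : ℂ) + c))
      (β * exp (((τ + β * x : ℝ) : ℂ) + c)) x := by
  have h1 : HasDerivAt (fun x : ℝ => ((τ + β * x : ℝ) : ℂ) + c) β x := by
    have : HasDerivAt (fun x : ℝ => τ + β * x) β x := by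
      simpa using ((hasDerivAt_id x).const_mul β).const_add τ
    exact (this.ofReal_comp).add_const c
  simpa [mul_comm] using h1.cexp

theorem hasDerivAt_exp_angle (τ : ℝ) (θ : ℝ) :
    HasDerivAt (fun θ : ℝ => exp ((τ : ℂ) + I * θ)) (I * exp ((τ : ℂ) + I * θ)) θ := by
  have h1 : HasDerivAt (fun θ : ℝ => (τ : ℂ) + I * θ) I θ := by
    simpa using (((hasDerivAt_id θ).ofReal_comp).const_mul I).const_add (τ : ℂ)
  simpa [mul_comm] using h1.cexp

/-- The second derivative of a circular mean along a line, for a smooth function that is invariant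
under real translations of the first variable. -/
theorem exists_hasDerivAt_circleMean {u : ℂ × (Fin m → ℂ) → ℝ} (hu : ContDiff ℝ ∞ u)
    (hinv : ∀ (s : ℂ) (z : Fin m → ℂ) (σ : ℝ), u (s + σ, z) = u (s, z))
    (a : Fin m → ℂ) (t τ α β : ℝ) : ∃ B' : ℝ → ℝ,
    (∀ x, HasDerivAt (fun x => ∫ θ in (0 : ℝ)..(2 * Real.pi),
      u (polarPoint a (t + α * x) (τ + β * x) θ)) (B' x) x) ∧
    ∀ x, HasDerivAt B' (∫ θ in (0 : ℝ)..(2 * Real.pi),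
      smoothLevi u (polarPoint a (t + α * x) (τ + β * x) θ)
        ((α : ℂ), (-(I * β) * exp (((τ + β * x : ℝ) : ℂ) + I * θ)) • a)) x := by
  -- `Px`, `Pxx` are the derivatives of `P` along the line, `Q`, `Qθ` those in the angle.
  set P : ℝ → ℝ → ℂ × (Fin m → ℂ) := fun x θ => polarPoint a (t + α * x) (τ + β * x) θ with hP
  set e : ℝ → ℝ → ℂ := fun x θ => exp (((τ + β * x : ℝ) : ℂ) + I * θ) with he
  set Px : ℝ → ℝ → ℂ × (Fin m → ℂ) := fun x θ => (I * α, (β * e x θ) • a) with hPx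
  set Pxx : ℝ → ℝ → ℂ × (Fin m → ℂ) := fun x θ => (0, (β * (β * e x θ)) • a) with hPxx
  set Q : ℝ → ℝ → ℂ × (Fin m → ℂ) := fun x θ => (0, (I * e x θ) • a) with hQ
  set Qθ : ℝ → ℝ → ℂ × (Fin m → ℂ) := fun x θ => (0, (I * (I * e x θ)) • a) with hQθ
  have hdx : ∀ x θ, HasDerivAt (fun x => e x θ) (β * e x θ) x := fun x θ =>
    hasDerivAt_exp_line τ β _ x
  have hdθ : ∀ x θ, HasDerivAt (fun θ => e x θ) (I * e x θ) θ := fun x θ =>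
    hasDerivAt_exp_angle _ θ
  have hP1 : ∀ x θ, HasDerivAt (fun x => P x θ) (Px x θ) x := by
    intro x θ
    refine HasDerivAt.prodMk ?_ ((hdx x θ).smul_const a)
    have : HasDerivAt (fun x : ℝ => t + α * x) α x := by
      simpa using ((hasDerivAt_id x).const_mul α).const_add t
    exact this.ofReal_comp.const_mul I
  have hP2 : ∀ x θ, HasDerivAt (fun x => Px x θ) (Pxx x θ) x := fun x θ =>
    (hasDerivAt_const x _).prodMk (((hdx x θ).const_mul (β : ℂ)).smul_const a)
  have hQ1 : ∀ x θ, HasDerivAt (fun θ => P x θ) (Q x θ) θ := fun x θ =>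
    (hasDerivAt_const θ _).prodMk ((hdθ x θ).smul_const a)
  have hQ2 : ∀ x θ, HasDerivAt (fun θ => Q x θ) (Qθ x θ) θ := fun x θ =>
    (hasDerivAt_const θ _).prodMk (((hdθ x θ).const_mul I).smul_const a)
  have hec : Continuous (Function.uncurry e) := by
    simp only [he, Function.uncurry_def]; fun_prop
  have hPc : Continuous (Function.uncurry P) := by
    simp only [hP, polarPoint, Function.uncurry_def]; fun_prop
  have hPxc : Continuous (Function.uncurry Px) := by
    have : Continuous fun p : ℝ × ℝ => e p.1 p.2 := hec
    simp only [hPx, Function.uncurry_def]; fun_prop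
  have hPxxc : Continuous (Function.uncurry Pxx) := by
    have : Continuous fun p : ℝ × ℝ => e p.1 p.2 := hec
    simp only [hPxx, Function.uncurry_def]; fun_prop
  have hQc : Continuous (Function.uncurry Q) := by
    have : Continuous fun p : ℝ × ℝ => e p.1 p.2 := hec
    simp only [hQ, Function.uncurry_def]; fun_prop
  have hQθc : Continuous (Function.uncurry Qθ) := by
    have : Continuous fun p : ℝ × ℝ => e p.1 p.2 := hec
    simp only [hQθ, Function.uncurry_def]; fun_prop
  have hu1 : ContDiff ℝ ∞ (fderiv ℝ u) := hu.fderiv_right (by simp)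
  have hu2 : ContDiff ℝ ∞ (fderiv ℝ (fderiv ℝ u)) := hu1.fderiv_right (by simp)
  have c0 : Continuous (Function.uncurry fun x θ => u (P x θ)) := hu.continuous.comp hPc
  have c1 : Continuous (Function.uncurry fun x θ => fderiv ℝ u (P x θ) (Px x θ)) :=
    (hu1.continuous.comp hPc).clm_apply hPxc
  have c2 : Continuous (Function.uncurry fun x θ =>
      fderiv ℝ (fderiv ℝ u) (P x θ) (Px x θ) (Px x θ) + fderiv ℝ u (P x θ) (Pxx x θ)) :=
    (((hu2.continuous.comp hPc).clm_apply hPxc).clm_apply hPxc).add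
      ((hu1.continuous.comp hPc).clm_apply hPxxc)
  have c3 : Continuous (Function.uncurry fun x θ =>
      fderiv ℝ (fderiv ℝ u) (P x θ) (Q x θ) (Q x θ) + fderiv ℝ u (P x θ) (Qθ x θ)) :=
    (((hu2.continuous.comp hPc).clm_apply hQc).clm_apply hQc).add
      ((hu1.continuous.comp hPc).clm_apply hQθc)
  refine ⟨fun x => ∫ θ in (0 : ℝ)..(2 * Real.pi), fderiv ℝ u (P x θ) (Px x θ),
    fun x => hasDerivAt_integral_of_continuous c0 c1
      (fun x θ => hasDerivAt_comp_curve hu (P := fun x => P x θ) (P' := fun x => Px x θ) (hP1 x θ)) x,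
    fun x => ?_⟩
  have hd := hasDerivAt_integral_of_continuous (a := 0) (b := 2 * Real.pi) c1 c2
    (fun x θ => hasDerivAt_fderiv_comp_curve hu (P := fun x => P x θ) (P' := fun x => Px x θ)
      (hP1 x θ) (hP2 x θ)) x
  convert hd using 1
  have hper : e x (2 * Real.pi) = e x 0 := by
    simp only [he]
    rw [← Complex.exp_periodic (((τ + β * x : ℝ) : ℂ) + I * (0 : ℝ))]
    congr 1
    push_cast
    ring
  -- The integrand is the second $\theta$-derivative of $u\circ P$, integrated over a full period.
  have hzero : ∫ θ in (0 : ℝ)..(2 * Real.pi),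
      (fderiv ℝ (fderiv ℝ u) (P x θ) (Q x θ) (Q x θ) + fderiv ℝ u (P x θ) (Qθ x θ)) = 0 := by
    rw [intervalIntegral.integral_eq_sub_of_hasDerivAt
      (fun θ _ => hasDerivAt_fderiv_comp_curve hu (P := fun θ => P x θ) (P' := fun θ => Q x θ)
      (hQ1 x θ) (hQ2 x θ)) ((c3.comp (Continuous.prodMk_right x)).intervalIntegrable _ _)]
    have h1 : P x (2 * Real.pi) = P x 0 := by
      change (_, e x (2 * Real.pi) • a) = (_, e x 0 • a)
      rw [hper]
    have h2 : Q x (2 * Real.pi) = Q x 0 := by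
      simp only [hQ, hper]
    rw [h1, h2, sub_self]
  -- For $\xi=(\alpha,-i\beta e\,a)$ the vector $i\xi$ is the velocity `Px`. Moreover $\xi+\beta Q$
  -- is a real multiple of $(1,0)$, which the Hessian annihilates, and `Pxx` is $-\beta^2$ times
  -- `Qθ`. So the Levi form is the second derivative along the line plus $\beta^2$ times the second
  -- angular derivative.
  have hpt : ∀ θ, smoothLevi u (P x θ) ((α : ℂ), (-(I * β) * e x θ) • a)
      = (fderiv ℝ (fderiv ℝ u) (P x θ) (Px x θ) (Px x θ) + fderiv ℝ u (P x θ) (Pxx x θ))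
      + β ^ 2 * (fderiv ℝ (fderiv ℝ u) (P x θ) (Q x θ) (Q x θ)
        + fderiv ℝ u (P x θ) (Qθ x θ)) := by
    intro θ
    have e1 : ((α : ℂ), (-(I * β) * e x θ) • a) = α • ((1 : ℂ), (0 : Fin m → ℂ)) + (-β) • Q x θ := by
      ext i
      · simp [hQ]
      · simp [hQ]; ring
    have e2 : I • ((α : ℂ), (-(I * β) * e x θ) • a) = Px x θ := by
      ext i
      · simp [hPx]
      · simp only [hPx, Prod.smul_mk, Pi.smul_apply, smul_eq_mul]
        linear_combination (-(β * e x θ * a i)) * I_sq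
    have e3 : Pxx x θ = (-(β ^ 2)) • Qθ x θ := by
      ext i
      · simp [hPxx, hQθ]
      · simp only [hPxx, hQθ, Prod.smul_mk, Pi.smul_apply, smul_eq_mul, real_smul]
        push_cast
        linear_combination (β ^ 2 * e x θ * a i) * I_sq
    rw [smoothLevi, e2, e1, fderiv_fderiv_apply_add_fst hu hinv, e3]
    simp
    ring
  have hsplit := intervalIntegral.integral_add (μ := volume) (a := 0) (b := 2 * Real.pi)
    (((c2.comp (Continuous.prodMk_right x))).intervalIntegrable _ _)
    (((c3.comp (Continuous.prodMk_right x)).const_smul (β ^ 2)).intervalIntegrable _ _)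
  rw [intervalIntegral.integral_congr (fun θ _ => hpt θ)]
  simp only [Function.comp_def, Function.uncurry_apply_pair, Pi.smul_apply, smul_eq_mul] at hsplit
  rw [hsplit, intervalIntegral.integral_const_mul, hzero, mul_zero, add_zero]

/-- A lower bound for the Levi form makes circular means, suitably corrected, convex along
lines. -/
theorem convexOn_circleMean_of_smooth {u : ℂ × (Fin m → ℂ) → ℝ} (hu : ContDiff ℝ ∞ u)
    (hinv : ∀ (s : ℂ) (z : Fin m → ℂ) (σ : ℝ), u (s + σ, z) = u (s, z))
    (a : Fin m → ℂ) (t τ α β K K' : ℝ)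
    (hL : ∀ x ∈ Icc (0 : ℝ) 1, ∀ θ ∈ Icc (0 : ℝ) (2 * Real.pi), ∀ μ : ℂ,
      -(4 * (K * ‖μ‖ ^ 2 + K' * α ^ 2)) ≤
        smoothLevi u (polarPoint a (t + α * x) (τ + β * x) θ) ((α : ℂ), μ • a)) :
    ConvexOn ℝ (Icc (0 : ℝ) 1) fun x =>
      (∫ θ in (0 : ℝ)..(2 * Real.pi), u (polarPoint a (t + α * x) (τ + β * x) θ))
        + 2 * Real.pi * (K * Real.exp (2 * (τ + β * x)) + 2 * K' * (t + α * x) ^ 2) := by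
  obtain ⟨B', h1, h2⟩ := exists_hasDerivAt_circleMean hu hinv a t τ α β
  have hl : ∀ s γ x : ℝ, HasDerivAt (fun x : ℝ => s + γ * x) γ x := fun s γ x => by
    simpa using ((hasDerivAt_id x).const_mul γ).const_add s
  -- The correction is chosen so that its second derivative is
  -- $2\pi\cdot4(K\beta^2e^{2\tau}+K'\alpha^2)$, with $\tau$ taken at the moving point. This offsets
  -- the lower bound for the Levi form, since $|\mu|^2=\beta^2e^{2\tau}$ there.
  have hq1 : ∀ x, HasDerivAt (fun x : ℝ =>
      2 * Real.pi * (K * Real.exp (2 * (τ + β * x)) + 2 * K' * (t + α * x) ^ 2))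
      (2 * Real.pi * (K * (2 * β) * Real.exp (2 * (τ + β * x)) + 4 * K' * α * (t + α * x))) x := by
    intro x
    refine (((((hl τ β x).const_mul 2).exp.const_mul K).add
      (((hl t α x).pow 2).const_mul (2 * K'))).const_mul (2 * Real.pi)).congr_deriv ?_
    simp
    ring
  have hq2 : ∀ x, HasDerivAt (fun x : ℝ =>
      2 * Real.pi * (K * (2 * β) * Real.exp (2 * (τ + β * x)) + 4 * K' * α * (t + α * x)))
      (2 * Real.pi * (4 * (K * (β ^ 2 * Real.exp (2 * (τ + β * x))) + K' * α ^ 2))) x := by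
    intro x
    refine (((((hl τ β x).const_mul 2).exp.const_mul (K * (2 * β))).add
      ((hl t α x).const_mul (4 * K' * α))).const_mul (2 * Real.pi)).congr_deriv ?_
    ring
  refine convexOn_of_hasDerivWithinAt2_nonneg (convex_Icc _ _)
    (fun x _ => ((h1 x).add (hq1 x)).continuousAt.continuousWithinAt)
    (fun x _ => ((h1 x).add (hq1 x)).hasDerivWithinAt)
    (fun x _ => ((h2 x).add (hq2 x)).hasDerivWithinAt) fun x hx => ?_
  have hx' : x ∈ Icc (0 : ℝ) 1 := interior_subset hx
  have hc : Continuous fun θ : ℝ => smoothLevi u (polarPoint a (t + α * x) (τ + β * x) θ)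
        ((α : ℂ), (-(I * β) * exp (((τ + β * x : ℝ) : ℂ) + I * θ)) • a) := by
    have hu1 : ContDiff ℝ ∞ (fderiv ℝ u) := hu.fderiv_right (by simp)
    have hu2 : Continuous (fderiv ℝ (fderiv ℝ u)) :=
      (hu1.fderiv_right (m := ∞) (by simp)).continuous
    unfold smoothLevi polarPoint
    fun_prop
  have hmono := intervalIntegral.integral_mono_on (a := 0) (b := 2 * Real.pi) (by positivity)
    (intervalIntegrable_const (μ := volume)
      (c := -(4 * (K * (β ^ 2 * Real.exp (2 * (τ + β * x))) + K' * α ^ 2))))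
    (hc.intervalIntegrable _ _) fun θ hθ => by
      have hn : ‖-(I * β) * exp (((τ + β * x : ℝ) : ℂ) + I * θ)‖ ^ 2
          = β ^ 2 * Real.exp (2 * (τ + β * x)) := by
        rw [norm_mul, norm_exp, mul_pow, ← Real.exp_nat_mul]
        simp
      rw [← hn]
      exact hL x hx' θ hθ _
  rw [intervalIntegral.integral_const, smul_eq_mul] at hmono
  linarith

/-! ### The weak Levi form and its mollifications. -/

open scoped Convolution

instance : (volume : Measure (ℂ × (Fin m → ℂ))).IsAddHaarMeasure :=
  Measure.prod.instIsAddHaarMeasure (volume : Measure ℂ) (volume : Measure (Fin m → ℂ))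

/-- The Levi form of the coefficient matrix `c`, in the direction `ξ`. -/
noncomputable def levi (c : Matrix (Idx m) (Idx m) ℂ) (ξ : ℂ × (Fin m → ℂ)) : ℂ :=
  ∑ p, ∑ q, c p q * (dcoord p ξ * star (dcoord q ξ))

theorem sum_coordVec (ξ : ℂ × (Fin m → ℂ)) : ∑ p, coordVec p (dcoord p ξ) = ξ := by
  ext i
  · simp [coordVec, dcoord, Prod.fst_sum]
  · simp [coordVec, dcoord, Prod.snd_sum, Finset.sum_apply, Pi.single_apply]

theorem coordVec_eq (p : Idx m) (c : ℂ) :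
    coordVec p c = c.re • coordVec p 1 + c.im • coordVec p I := by
  rcases p with p | p
  · ext i <;> simp [coordVec]
  · ext i
    · simp [coordVec]
    · by_cases h : i = p <;> simp [coordVec, h]

theorem I_smul_coordVec (p : Idx m) (c : ℂ) : I • coordVec p c = coordVec p (I * c) := by
  rcases p with p | p
  · ext i <;> simp [coordVec]
  · ext i
    · simp [coordVec]
    · by_cases h : i = p <;> simp [coordVec, h]

/-- Both sides are the complex-linear part of $L$, evaluated at $\xi$. -/
theorem sum_dcoord_mul (L : ℂ × (Fin m → ℂ) →L[ℝ] ℂ) (ξ : ℂ × (Fin m → ℂ)) :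
    ∑ p, dcoord p ξ * ((L (coordVec p 1) - I * L (coordVec p I)) / 2)
      = (L ξ - I * L (I • ξ)) / 2 := by
  conv_rhs => rw [← sum_coordVec ξ]
  simp only [Finset.smul_sum, map_sum, Finset.mul_sum, ← Finset.sum_sub_distrib, Finset.sum_div]
  refine Finset.sum_congr rfl fun p _ => ?_
  rw [I_smul_coordVec, coordVec_eq p (dcoord p ξ), coordVec_eq p (I * dcoord p ξ)]
  simp only [map_add, map_smul, real_smul, I_mul_re, I_mul_im, ofReal_neg]
  conv_lhs => rw [← re_add_im (dcoord p ξ)]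
  linear_combination (-((dcoord p ξ).im * L (coordVec p I) / 2)) * I_sq

theorem sum_star_dcoord_mul (L : ℂ × (Fin m → ℂ) →L[ℝ] ℂ) (ξ : ℂ × (Fin m → ℂ)) :
    ∑ p, star (dcoord p ξ) * ((L (coordVec p 1) + I * L (coordVec p I)) / 2)
      = (L ξ + I * L (I • ξ)) / 2 := by
  conv_rhs => rw [← sum_coordVec ξ]
  simp only [Finset.smul_sum, map_sum, Finset.mul_sum, ← Finset.sum_add_distrib, Finset.sum_div]
  refine Finset.sum_congr rfl fun p _ => ?_
  rw [I_smul_coordVec, coordVec_eq p (dcoord p ξ), coordVec_eq p (I * dcoord p ξ)]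
  simp only [map_add, map_smul, real_smul, I_mul_re, I_mul_im, ofReal_neg]
  conv_lhs => rw [← re_add_im (dcoord p ξ)]
  simp only [RCLike.star_def, map_add, map_mul, conj_ofReal, conj_I]
  linear_combination (-((dcoord p ξ).im * L (coordVec p I) / 2)) * I_sq

theorem contDiff_wirtingerBar {χ : ℂ × (Fin m → ℂ) → ℂ} (hχ : ContDiff ℝ ∞ χ) (q : Idx m) :
    ContDiff ℝ ∞ (wirtingerBar q χ) := by
  have h1 : ContDiff ℝ ∞ (fderiv ℝ χ) := hχ.fderiv_right (by simp)
  unfold wirtingerBar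
  fun_prop

theorem contDiff_wirtinger {χ : ℂ × (Fin m → ℂ) → ℂ} (hχ : ContDiff ℝ ∞ χ) (q : Idx m) :
    ContDiff ℝ ∞ (wirtinger q χ) := by
  have h1 : ContDiff ℝ ∞ (fderiv ℝ χ) := hχ.fderiv_right (by simp)
  unfold wirtinger
  fun_prop

/-- Taking the antilinear part in one slot and the linear part in the other leaves the Hessian on
$\xi$ and $i\xi$; the cross terms cancel by symmetry. The denominator $4$ is the factor between
`smoothLevi` and `levi`. -/
theorem sum_wirtinger_wirtingerBar {χ : ℂ × (Fin m → ℂ) → ℂ} (hχ : ContDiff ℝ ∞ χ)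
    (y ξ : ℂ × (Fin m → ℂ)) :
    ∑ p, ∑ q, wirtinger p (wirtingerBar q χ) y * (dcoord p ξ * star (dcoord q ξ))
      = (fderiv ℝ (fderiv ℝ χ) y ξ ξ + fderiv ℝ (fderiv ℝ χ) y (I • ξ) (I • ξ)) / 4 := by
  have h1 : ContDiff ℝ ∞ (fderiv ℝ χ) := hχ.fderiv_right (by simp)
  have hd : DifferentiableAt ℝ (fderiv ℝ χ) y := h1.differentiable (by simp) y
  have hs : fderiv ℝ (fderiv ℝ χ) y ξ (I • ξ) = fderiv ℝ (fderiv ℝ χ) y (I • ξ) ξ :=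
    (hχ.contDiffAt.isSymmSndFDerivAt (by
      simpa using WithTop.coe_le_coe.2 (le_top : (2 : ℕ∞) ≤ ⊤))) _ _
  have hbar : ∀ q, DifferentiableAt ℝ (wirtingerBar q χ) y := fun q =>
    (contDiff_wirtingerBar hχ q).differentiable (by simp) y
  set D : ℂ × (Fin m → ℂ) →L[ℝ] ℂ := fderiv ℝ
    (fun y => (fderiv ℝ χ y ξ + I * fderiv ℝ χ y (I • ξ)) / 2) y with hD
  have hDv : ∀ v, D v = (fderiv ℝ (fderiv ℝ χ) y v ξ
      + I * fderiv ℝ (fderiv ℝ χ) y v (I • ξ)) / 2 := by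
    intro v
    have e1 := hd.hasFDerivAt.clm_apply (hasFDerivAt_const ξ y)
    have e2 := hd.hasFDerivAt.clm_apply (hasFDerivAt_const (I • ξ) y)
    have e3 := ((e1.add (e2.const_mul I)).mul_const (2⁻¹ : ℂ))
    have e4 := e3.fderiv
    simp only [Pi.add_apply, ← div_eq_mul_inv] at e4
    rw [hD, e4]
    simp
    ring
  have hsum : ∑ q, star (dcoord q ξ) • fderiv ℝ (wirtingerBar q χ) y = D := by
    have e1 : (fun y => (fderiv ℝ χ y ξ + I * fderiv ℝ χ y (I • ξ)) / 2)
        = fun y => ∑ q, star (dcoord q ξ) * wirtingerBar q χ y := by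
      funext y
      exact (sum_star_dcoord_mul (fderiv ℝ χ y) ξ).symm
    rw [hD, e1]
    have := HasFDerivAt.fun_sum (u := Finset.univ) fun q _ =>
      ((hbar q).hasFDerivAt.const_mul (star (dcoord q ξ)))
    exact this.fderiv.symm
  have hDp : ∀ p, ∑ q, wirtinger p (wirtingerBar q χ) y * star (dcoord q ξ)
      = (D (coordVec p 1) - I * D (coordVec p I)) / 2 := by
    intro p
    rw [← hsum]
    simp only [wirtinger, _root_.sum_apply, _root_.smul_apply, Finset.mul_sum,
      ← Finset.sum_sub_distrib, Finset.sum_div, smul_eq_mul]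
    exact Finset.sum_congr rfl fun q _ => by ring
  have : ∀ p, ∑ q, wirtinger p (wirtingerBar q χ) y * (dcoord p ξ * star (dcoord q ξ))
      = dcoord p ξ * ((D (coordVec p 1) - I * D (coordVec p I)) / 2) := by
    intro p
    rw [← hDp, Finset.mul_sum]
    exact Finset.sum_congr rfl fun q _ => by ring
  rw [Finset.sum_congr rfl fun p _ => this p, sum_dcoord_mul, hDv, hDv, hs]
  linear_combination (-(fderiv ℝ (fderiv ℝ χ) y (I • ξ) (I • ξ)) / 4) * I_sq

section Convolution

variable {M : Type*} [NormedAddCommGroup M] [NormedSpace ℝ M] [MeasurableSpace M] [BorelSpace M]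
  {μ : Measure M} [SFinite μ] [μ.IsAddLeftInvariant] [μ.IsNegInvariant]

/-- Derivatives fall on the kernel, so the other factor need only be locally integrable. -/
theorem fderiv_convolution_apply {ρ W : M → ℝ} (hρ : ContDiff ℝ ∞ ρ) (hρc : HasCompactSupport ρ)
    (hW : LocallyIntegrable W μ) (x v : M) :
    fderiv ℝ (ρ ⋆[ContinuousLinearMap.lsmul ℝ ℝ, μ] W) x v
      = ((fun y => fderiv ℝ ρ y v) ⋆[ContinuousLinearMap.lsmul ℝ ℝ, μ] W) x := by
  rw [(hρc.hasFDerivAt_convolution_left (ContinuousLinearMap.lsmul ℝ ℝ)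
    (hρ.of_le (by simp)) hW x).fderiv]
  have hc : Continuous (fderiv ℝ ρ) := (hρ.fderiv_right (m := ∞) (by simp)).continuous
  have := (hρc.fderiv ℝ).convolutionExists_left
    (ContinuousLinearMap.precompL M (ContinuousLinearMap.lsmul ℝ ℝ)) hc hW x
  rw [convolution_def, ContinuousLinearMap.integral_apply this]
  rfl

theorem fderiv_fderiv_convolution_apply {ρ W : M → ℝ} (hρ : ContDiff ℝ ∞ ρ)
    (hρc : HasCompactSupport ρ) (hW : LocallyIntegrable W μ) (x v w : M) :
    fderiv ℝ (fderiv ℝ (ρ ⋆[ContinuousLinearMap.lsmul ℝ ℝ, μ] W)) x v w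
      = ∫ y, fderiv ℝ (fderiv ℝ ρ) (x - y) v w * W y ∂μ := by
  have h1 : ContDiff ℝ ∞ (fderiv ℝ ρ) := hρ.fderiv_right (by simp)
  have h2 : ContDiff ℝ ∞ fun y => fderiv ℝ ρ y w := h1.clm_apply contDiff_const
  have h3 : ContDiff ℝ ∞ (ρ ⋆[ContinuousLinearMap.lsmul ℝ ℝ, μ] W) :=
    hρc.contDiff_convolution_left _ hρ hW
  have h4 : DifferentiableAt ℝ (fderiv ℝ (ρ ⋆[ContinuousLinearMap.lsmul ℝ ℝ, μ] W)) x :=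
    (h3.fderiv_right (m := ∞) (by simp)).differentiable (by simp) x
  have h5 : fderiv ℝ (fderiv ℝ (ρ ⋆[ContinuousLinearMap.lsmul ℝ ℝ, μ] W)) x v w
      = fderiv ℝ (fun x => fderiv ℝ (ρ ⋆[ContinuousLinearMap.lsmul ℝ ℝ, μ] W) x w) x v := by
    rw [fderiv_clm_apply h4 (differentiableAt_const w)]
    simp
  have h6 : (fun x => fderiv ℝ (ρ ⋆[ContinuousLinearMap.lsmul ℝ ℝ, μ] W) x w)
      = ((fun y => fderiv ℝ ρ y w) ⋆[ContinuousLinearMap.lsmul ℝ ℝ, μ] W) :=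
    funext fun x => fderiv_convolution_apply hρ hρc hW x w
  rw [h5, h6, fderiv_convolution_apply h2 (hρc.fderiv_apply ℝ w) hW, convolution_lsmul_swap]
  refine integral_congr_ae (Eventually.of_forall fun y => ?_)
  have h7 : DifferentiableAt ℝ (fderiv ℝ ρ) (x - y) := h1.differentiable (by simp) _
  simp only [smul_eq_mul]
  rw [fderiv_clm_apply h7 (differentiableAt_const w)]
  simp

end Convolution

theorem integrable_mul_of_support_subset {M : Type*} [TopologicalSpace M] [MeasurableSpace M]
    [OpensMeasurableSpace M] {μ : Measure M} [IsFiniteMeasureOnCompacts μ] {f g : M → ℂ} {K : Set M}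
    [T2Space M] [SecondCountableTopology M]
    (hK : IsCompact K) (hf : ContinuousOn f K) (hg : ContinuousOn g K)
    (hs : Function.support g ⊆ K) : Integrable (fun y => f y * g y) μ := by
  rw [← integrableOn_iff_integrable_of_support_subset (s := K)]
  · exact (hf.mul hg).integrableOn_compact hK
  · exact fun y hy => hs (right_ne_zero_of_mul hy)

theorem fderiv_eq_zero_of_eventuallyEq {χ : ℂ × (Fin m → ℂ) → ℂ} {y : ℂ × (Fin m → ℂ)}
    (h : χ =ᶠ[𝓝 y] 0) : fderiv ℝ χ y = 0 := by
  rw [h.fderiv_eq]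
  exact fderiv_const_apply 0

theorem support_wirtinger_wirtingerBar (χ : ℂ × (Fin m → ℂ) → ℂ) (p q : Idx m) :
    Function.support (wirtinger p (wirtingerBar q χ)) ⊆ tsupport χ := by
  intro y hy
  by_contra hn
  apply hy
  have h1 : ∀ᶠ x in 𝓝 y, χ =ᶠ[𝓝 x] 0 :=
    (notMem_tsupport_iff_eventuallyEq.1 hn).eventually_nhds
  have h2 : wirtingerBar q χ =ᶠ[𝓝 y] 0 := by
    filter_upwards [h1] with x hx
    simp [wirtingerBar, fderiv_eq_zero_of_eventuallyEq hx]
  simp [wirtinger, fderiv_eq_zero_of_eventuallyEq h2]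

/-- The defining identity of the weak `∂∂bar`, contracted with a vector. -/
theorem HasDdbar.integral_levi {w : ℂ × (Fin m → ℂ) → ℝ}
    {c : ℂ × (Fin m → ℂ) → Matrix (Idx m) (Idx m) ℂ} {A : Set (ℂ × (Fin m → ℂ))}
    (hw : HasDdbar w c A) {χ : ℂ × (Fin m → ℂ) → ℂ} (hχ : ContDiff ℝ ∞ χ)
    (hc : HasCompactSupport χ) (hs : tsupport χ ⊆ interior A) (ξ : ℂ × (Fin m → ℂ)) :
    ∫ y, (w y : ℂ) * ((fderiv ℝ (fderiv ℝ χ) y ξ ξ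
      + fderiv ℝ (fderiv ℝ χ) y (I • ξ) (I • ξ)) / 4) = ∫ y, levi (c y) ξ * χ y := by
  have hK : tsupport χ ⊆ A := hs.trans interior_subset
  have i1 : ∀ p q, Integrable (fun y => (w y : ℂ) * (wirtinger p (wirtingerBar q χ) y)) := by
    intro p q
    refine integrable_mul_of_support_subset hc
      (continuous_ofReal.comp_continuousOn (hw.continuousOn.mono hK))
      (contDiff_wirtinger (contDiff_wirtingerBar hχ q) p).continuous.continuousOn ?_
    exact support_wirtinger_wirtingerBar χ p q
  have i2 : ∀ p q, Integrable (fun y => c y p q * χ y) := by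
    intro p q
    refine integrable_mul_of_support_subset hc ?_ hχ.continuous.continuousOn (subset_tsupport χ)
    exact (continuous_id.matrix_elem p q).comp_continuousOn (hw.continuousOn_coeff.mono hK)
  have e1 : ∀ y, (w y : ℂ) * ((fderiv ℝ (fderiv ℝ χ) y ξ ξ
      + fderiv ℝ (fderiv ℝ χ) y (I • ξ) (I • ξ)) / 4)
      = ∑ p, ∑ q, (w y : ℂ) * (wirtinger p (wirtingerBar q χ) y)
        * (dcoord p ξ * star (dcoord q ξ)) := by
    intro y
    rw [← sum_wirtinger_wirtingerBar hχ, Finset.mul_sum]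
    refine Finset.sum_congr rfl fun p _ => ?_
    rw [Finset.mul_sum]
    exact Finset.sum_congr rfl fun q _ => by ring
  have e2 : ∀ y, levi (c y) ξ * χ y
      = ∑ p, ∑ q, c y p q * χ y * (dcoord p ξ * star (dcoord q ξ)) := by
    intro y
    rw [levi, Finset.sum_mul]
    refine Finset.sum_congr rfl fun p _ => ?_
    rw [Finset.sum_mul]
    exact Finset.sum_congr rfl fun q _ => by ring
  simp only [e1, e2]
  rw [integral_finsetSum _ fun p _ => integrable_finsetSum _ fun q _ => (i1 p q).mul_const _,
    integral_finsetSum _ fun p _ => integrable_finsetSum _ fun q _ => (i2 p q).mul_const _]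
  refine Finset.sum_congr rfl fun p _ => ?_
  rw [integral_finsetSum _ fun q _ => (i1 p q).mul_const _,
    integral_finsetSum _ fun q _ => (i2 p q).mul_const _]
  refine Finset.sum_congr rfl fun q _ => ?_
  rw [integral_mul_const, integral_mul_const, hw.weak χ hχ hc hs p q]

theorem fderiv_fderiv_ofReal_comp_sub {ρ : ℂ × (Fin m → ℂ) → ℝ} (hρ : ContDiff ℝ ∞ ρ)
    (x y v w : ℂ × (Fin m → ℂ)) :
    fderiv ℝ (fderiv ℝ fun y => ((ρ (x - y) : ℝ) : ℂ)) y v w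
      = ((fderiv ℝ (fderiv ℝ ρ) (x - y) v w : ℝ) : ℂ) := by
  have h1 : ContDiff ℝ ∞ (fderiv ℝ ρ) := hρ.fderiv_right (by simp)
  have hsub : ∀ y, HasFDerivAt (fun y => x - y) (-ContinuousLinearMap.id ℝ (ℂ × (Fin m → ℂ))) y :=
    fun y => (hasFDerivAt_id y).const_sub x
  have hcf : ∀ y, HasFDerivAt (fun y => ((ρ (x - y) : ℝ) : ℂ))
      (-(ofRealCLM ∘L fderiv ℝ ρ (x - y))) y := by
    intro y
    have := (ofRealCLM.hasFDerivAt (x := ρ (x - y))).comp y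
      ((hρ.differentiable (by simp) (x - y)).hasFDerivAt.comp y (hsub y))
    refine HasFDerivAt.congr_fderiv this ?_
    ext <;> simp
  have hfd : (fderiv ℝ fun y => ((ρ (x - y) : ℝ) : ℂ)) = fun y => -(ofRealCLM ∘L fderiv ℝ ρ (x - y)) :=
    funext fun y => (hcf y).fderiv
  rw [hfd]
  have h2 : HasFDerivAt (fun y => fderiv ℝ ρ (x - y))
      ((fderiv ℝ (fderiv ℝ ρ) (x - y)) ∘L (-ContinuousLinearMap.id ℝ (ℂ × (Fin m → ℂ)))) y :=
    (h1.differentiable (by simp) (x - y)).hasFDerivAt.comp y (hsub y)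
  have h3 := ((ContinuousLinearMap.compL ℝ (ℂ × (Fin m → ℂ)) ℝ ℂ ofRealCLM).hasFDerivAt
    (x := fderiv ℝ ρ (x - y))).comp y h2
  have h4 := h3.neg.fderiv
  have h5 : fderiv ℝ (fun y => -(ofRealCLM ∘L fderiv ℝ ρ (x - y))) y = _ := h4
  rw [h5]
  simp

/-- The Levi form of a mollification is the mollification of the weak Levi form. -/
theorem HasDdbar.smoothLevi_convolution {w : ℂ × (Fin m → ℂ) → ℝ}
    {c : ℂ × (Fin m → ℂ) → Matrix (Idx m) (Idx m) ℂ} {A : Set (ℂ × (Fin m → ℂ))}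
    (hw : HasDdbar w c A) {ρ W : ℂ × (Fin m → ℂ) → ℝ} (hρ : ContDiff ℝ ∞ ρ)
    (hρc : HasCompactSupport ρ) (hW : LocallyIntegrable W) (hWw : ∀ y ∈ interior A, W y = w y)
    (x : ℂ × (Fin m → ℂ)) (hx : ∀ y, x - y ∈ tsupport ρ → y ∈ interior A)
    (ξ : ℂ × (Fin m → ℂ)) :
    ((smoothLevi (ρ ⋆[ContinuousLinearMap.lsmul ℝ ℝ, volume] W) x ξ : ℝ) : ℂ)
      = 4 * ∫ y, levi (c y) ξ * (ρ (x - y) : ℂ) := by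
  -- The translated, reflected kernel serves as test function in the weak identity at $x$.
  set χ : ℂ × (Fin m → ℂ) → ℂ := fun y => ((ρ (x - y) : ℝ) : ℂ) with hχdef
  have hχ : ContDiff ℝ ∞ χ := ofRealCLM.contDiff.comp (hρ.comp (contDiff_const.sub contDiff_id))
  have hsub : Function.support χ ⊆ (fun y => x - y) ⁻¹' tsupport ρ := by
    intro y hy
    apply subset_tsupport ρ
    intro h0
    apply hy
    simp [hχdef, h0]
  have hts : tsupport χ ⊆ (fun y => x - y) ⁻¹' tsupport ρ :=
    closure_minimal hsub ((isClosed_tsupport ρ).preimage (by fun_prop))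
  have hχc : HasCompactSupport χ := by
    have : HasCompactSupport fun y => ρ (x - y) :=
      hρc.comp_homeomorph (Homeomorph.subLeft x)
    exact this.comp_left (g := fun r : ℝ => (r : ℂ)) (by simp)
  have h1 := hw.integral_levi hχ hχc (fun y hy => hx y (hts hy)) ξ
  rw [← h1, smoothLevi, fderiv_fderiv_convolution_apply hρ hρc hW,
    fderiv_fderiv_convolution_apply hρ hρc hW]
  have h2c : Continuous (fderiv ℝ (fderiv ℝ ρ)) :=
    ((hρ.fderiv_right (m := ∞) (by simp)).fderiv_right (m := ∞) (by simp)).continuous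
  have hint : ∀ v : ℂ × (Fin m → ℂ),
      Integrable fun y => fderiv ℝ (fderiv ℝ ρ) (x - y) v v * W y := by
    intro v
    have hcs : HasCompactSupport fun y => fderiv ℝ (fderiv ℝ ρ) (x - y) v v := by
      have : HasCompactSupport fun y => fderiv ℝ (fderiv ℝ ρ) (x - y) :=
        ((hρc.fderiv ℝ).fderiv ℝ).comp_homeomorph (Homeomorph.subLeft x)
      exact this.comp_left (g := fun L => L v v) (by simp)
    have hcont : Continuous fun y => fderiv ℝ (fderiv ℝ ρ) (x - y) v v := by fun_prop
    simpa only [smul_eq_mul] using hW.integrable_smul_left_of_hasCompactSupport hcont hcs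
  rw [← integral_add (hint _) (hint _), ← integral_complex_ofReal, ← integral_const_mul]
  refine integral_congr_ae (Eventually.of_forall fun y => ?_)
  simp only [hχdef, fderiv_fderiv_ofReal_comp_sub hρ]
  by_cases hy : x - y ∈ tsupport ρ
  · rw [hWw y (hx y hy)]
    push_cast
    ring
  · have : fderiv ℝ (fderiv ℝ ρ) (x - y) = 0 := by
      have : x - y ∉ tsupport (fderiv ℝ ρ) := fun h => hy (tsupport_fderiv_subset ℝ h)
      have h3 : x - y ∉ tsupport (fderiv ℝ (fderiv ℝ ρ)) :=
        fun h => this (tsupport_fderiv_subset ℝ h)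
      exact image_eq_zero_of_notMem_tsupport h3
    simp [this]

theorem locallyIntegrable_indicator {M : Type*} [TopologicalSpace M] [MeasurableSpace M]
    [LocallyCompactSpace M] [T2Space M] [OpensMeasurableSpace M] {μ : Measure M}
    [IsFiniteMeasureOnCompacts μ] {A : Set M} (hA : IsClosed A) {w : M → ℝ}
    (hw : ContinuousOn w A) : LocallyIntegrable (A.indicator w) μ := by
  rw [locallyIntegrable_iff]
  intro k hk
  rw [IntegrableOn, integrable_indicator_iff hA.measurableSet, IntegrableOn,
    Measure.restrict_restrict hA.measurableSet]
  exact (hw.mono inter_subset_left).integrableOn_compact (hk.inter_left hA)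

theorem isClosed_closedStrip : IsClosed closedStrip :=
  (isClosed_le continuous_const continuous_im).inter (isClosed_le continuous_im continuous_const)

theorem add_ofReal_mem_closedStrip {s : ℂ} {σ : ℝ} : s + σ ∈ closedStrip ↔ s ∈ closedStrip := by
  simp [closedStrip]

theorem continuous_levi (ξ : ℂ × (Fin m → ℂ)) :
    Continuous fun c : Matrix (Idx m) (Idx m) ℂ => levi c ξ := by
  unfold levi
  refine continuous_finsetSum _ fun p _ => continuous_finsetSum _ fun q _ => ?_
  exact (continuous_id.matrix_elem p q).mul continuous_const

/-- A lower bound for the weak Levi form passes to mollifications. -/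
theorem HasDdbar.le_smoothLevi_convolution {w : ℂ × (Fin m → ℂ) → ℝ}
    {c : ℂ × (Fin m → ℂ) → Matrix (Idx m) (Idx m) ℂ} {A U : Set (ℂ × (Fin m → ℂ))}
    (hw : HasDdbar w c A) {W : ℂ × (Fin m → ℂ) → ℝ} (hW : LocallyIntegrable W)
    (hWw : ∀ y ∈ interior A, W y = w y) (hUA : U ⊆ interior A)
    (φ : ContDiffBump (0 : ℂ × (Fin m → ℂ))) (x : ℂ × (Fin m → ℂ))
    (hx : Metric.closedBall x φ.rOut ⊆ U) (ξ : ℂ × (Fin m → ℂ)) (k : ℝ)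
    (hk : ∀ y ∈ U, k ≤ (levi (c y) ξ).re) :
    4 * k ≤ smoothLevi (φ.normed volume ⋆[ContinuousLinearMap.lsmul ℝ ℝ, volume] W) x ξ := by
  set ρ := φ.normed (volume : Measure (ℂ × (Fin m → ℂ))) with hρdef
  have hρ : ContDiff ℝ ∞ ρ := φ.contDiff_normed
  have hρc : HasCompactSupport ρ := φ.hasCompactSupport_normed
  have hmem : ∀ y, x - y ∈ tsupport ρ → y ∈ Metric.closedBall x φ.rOut := by
    intro y hy
    rw [hρdef, φ.tsupport_normed_eq, mem_closedBall_zero_iff] at hy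
    rwa [Metric.mem_closedBall, dist_comm, dist_eq_norm]
  have h1 := hw.smoothLevi_convolution hρ hρc hW hWw x (fun y hy => hUA (hx (hmem y hy))) ξ
  have hK : IsCompact (Metric.closedBall x φ.rOut) := isCompact_closedBall _ _
  have hcont : Continuous fun y => ρ (x - y) := by
    have := hρ.continuous
    fun_prop
  have hint : Integrable fun y => levi (c y) ξ * (ρ (x - y) : ℂ) := by
    refine integrable_mul_of_support_subset hK ?_
      (continuous_ofReal.comp hcont).continuousOn ?_
    · exact (continuous_levi ξ).comp_continuousOn
        (hw.continuousOn_coeff.mono (hx.trans (hUA.trans interior_subset)))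
    · intro y hy
      apply hmem
      apply subset_tsupport ρ
      intro h0
      apply hy
      simp [h0]
  have h2 : smoothLevi (ρ ⋆[ContinuousLinearMap.lsmul ℝ ℝ, volume] W) x ξ
      = 4 * ∫ y, (levi (c y) ξ * (ρ (x - y) : ℂ)).re := by
    have h3 := congrArg Complex.re h1
    rw [ofReal_re] at h3
    rw [h3]
    have h4 : (∫ y, (levi (c y) ξ * (ρ (x - y) : ℂ)).re)
        = (∫ y, levi (c y) ξ * (ρ (x - y) : ℂ)).re := integral_re hint
    rw [h4]
    simp
  have hone : ∫ y, ρ (x - y) = 1 := by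
    rw [integral_sub_left_eq_self (fun y => ρ y) volume x]
    exact φ.integral_normed
  have hρint : Integrable fun y => ρ (x - y) := by
    refine (integrable_comp_sub_left (fun y => ρ y) x).2 ?_
    exact hρ.continuous.integrable_of_hasCompactSupport hρc
  rw [h2]
  have h5 : k = ∫ y, k * ρ (x - y) := by
    rw [integral_const_mul, hone, mul_one]
  refine mul_le_mul_of_nonneg_left ?_ (by norm_num)
  rw [h5]
  refine integral_mono (hρint.const_mul k) hint.re fun y => ?_
  change k * ρ (x - y) ≤ (levi (c y) ξ * (ρ (x - y) : ℂ)).re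
  rw [re_mul_ofReal]
  by_cases hy : x - y ∈ tsupport ρ
  · exact mul_le_mul_of_nonneg_right (hk y (hx (hmem y hy))) (φ.nonneg_normed _)
  · rw [image_eq_zero_of_notMem_tsupport hy]
    simp

/-- A lower bound for the weak Levi form makes circular means, suitably corrected, convex along
lines. -/
theorem HasDdbar.convexOn_circleMean {w : ℂ × (Fin m → ℂ) → ℝ}
    {c : ℂ × (Fin m → ℂ) → Matrix (Idx m) (Idx m) ℂ} {R : ℝ}
    (hw : HasDdbar w c (closedStrip ×ˢ Metric.closedBall 0 R))
    (hinv : ∀ s ∈ closedStrip, ∀ z ∈ Metric.closedBall (0 : Fin m → ℂ) R, ∀ σ : ℝ,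
      w (s + σ, z) = w (s, z))
    (a : Fin m → ℂ) (t τ α β K K' : ℝ) {U : Set (ℂ × (Fin m → ℂ))} (hU : IsOpen U)
    (hUA : U ⊆ interior (closedStrip ×ˢ Metric.closedBall 0 R))
    (hP : ∀ x ∈ Icc (0 : ℝ) 1, ∀ θ ∈ Icc (0 : ℝ) (2 * Real.pi),
      polarPoint a (t + α * x) (τ + β * x) θ ∈ U)
    (hL : ∀ y ∈ U, ∀ μ : ℂ, -(K * ‖μ‖ ^ 2 + K' * α ^ 2) ≤ (levi (c y) ((α : ℂ), μ • a)).re) :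
    ConvexOn ℝ (Icc (0 : ℝ) 1) fun x =>
      (∫ θ in (0 : ℝ)..(2 * Real.pi), w (polarPoint a (t + α * x) (τ + β * x) θ))
        + 2 * Real.pi * (K * Real.exp (2 * (τ + β * x)) + 2 * K' * (t + α * x) ^ 2) := by
  set A : Set (ℂ × (Fin m → ℂ)) := closedStrip ×ˢ Metric.closedBall 0 R with hA
  have hAc : IsClosed A := isClosed_closedStrip.prod Metric.isClosed_closedBall
  -- Extension by zero makes the convolution global. As $A$ is invariant under real translations of
  -- $s$, so are $W$ and its mollifications.
  set W := A.indicator w with hWdef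
  have hW : LocallyIntegrable W volume := locallyIntegrable_indicator hAc hw.continuousOn
  have hWw : ∀ y ∈ A, W y = w y := fun y hy => indicator_of_mem hy _
  have hWinv : ∀ (s : ℂ) (z : Fin m → ℂ) (σ : ℝ), W (s + σ, z) = W (s, z) := by
    intro s z σ
    by_cases h : (s, z) ∈ A
    · have h' : (s + σ, z) ∈ A := ⟨add_ofReal_mem_closedStrip.2 h.1, h.2⟩
      rw [hWw _ h, hWw _ h', hinv s h.1 z h.2]
    · have h' : (s + σ, z) ∉ A := fun h' => h ⟨add_ofReal_mem_closedStrip.1 h'.1, h'.2⟩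
      rw [hWdef, indicator_of_notMem h, indicator_of_notMem h']
  set Γ := (fun p : ℝ × ℝ => polarPoint a (t + α * p.1) (τ + β * p.1) p.2) ''
    (Icc (0 : ℝ) 1 ×ˢ Icc (0 : ℝ) (2 * Real.pi)) with hΓ
  have hcurve : Continuous fun p : ℝ × ℝ => polarPoint a (t + α * p.1) (τ + β * p.1) p.2 := by
    unfold polarPoint
    fun_prop
  have hΓc : IsCompact Γ := (isCompact_Icc.prod isCompact_Icc).image hcurve
  have hΓU : Γ ⊆ U := by
    rintro _ ⟨p, hp, rfl⟩
    exact hP _ hp.1 _ hp.2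
  have hWcont : ∀ y ∈ Γ, ContinuousAt W y := by
    intro y hy
    have h1 : A ∈ 𝓝 y := mem_interior_iff_mem_nhds.1 (hUA (hΓU hy))
    refine (hw.continuousOn.continuousAt h1).congr ?_
    filter_upwards [h1] with z hz using (hWw z hz).symm
  set f := fun x : ℝ =>
      (∫ θ in (0 : ℝ)..(2 * Real.pi), w (polarPoint a (t + α * x) (τ + β * x) θ))
        + 2 * Real.pi * (K * Real.exp (2 * (τ + β * x)) + 2 * K' * (t + α * x) ^ 2) with hf
  -- Convexity survives uniform limits, so it suffices to approximate by circular means of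
  -- mollifications.
  have happrox : ∀ ε > 0, ∃ F : ℝ → ℝ, ConvexOn ℝ (Icc (0 : ℝ) 1) F ∧
      ∀ x ∈ Icc (0 : ℝ) 1, |F x - f x| ≤ ε * (2 * Real.pi) := by
    intro ε hε
    obtain ⟨δ, hδ, hδU⟩ := hΓc.exists_cthickening_subset_open hU hΓU
    obtain ⟨δ', hδ', hunif⟩ := Metric.mem_uniformity_dist.1
      (hΓc.uniformContinuousAt_of_continuousAt W hWcont (Metric.dist_mem_uniformity hε))
    -- Radius at most $\delta$ keeps the averaging balls inside $U$, where the Levi bound holds;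
    -- radius at most $\delta'$ makes the mollification $\varepsilon$-close to $W$ on $\Gamma$.
    let φ : ContDiffBump (0 : ℂ × (Fin m → ℂ)) :=
      ⟨min δ δ' / 2, min δ δ', by positivity, by linarith [lt_min hδ hδ']⟩
    set u := φ.normed volume ⋆[ContinuousLinearMap.lsmul ℝ ℝ, volume] W with hu
    have hsm : ContDiff ℝ ∞ u :=
      φ.hasCompactSupport_normed.contDiff_convolution_left _ φ.contDiff_normed hW
    have huinv : ∀ (s : ℂ) (z : Fin m → ℂ) (σ : ℝ), u (s + σ, z) = u (s, z) := by
      intro s z σ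
      rw [hu, convolution_lsmul, convolution_lsmul]
      refine integral_congr_ae (Eventually.of_forall fun y => ?_)
      have := hWinv (s - y.1) (z - y.2) σ
      have e : (s + (σ : ℂ), z) - y = (s - y.1 + σ, z - y.2) := by
        ext <;> simp; ring
      simp only [e, this]
      rfl
    refine ⟨_, convexOn_circleMean_of_smooth hsm huinv a t τ α β K K' ?_, ?_⟩
    · intro x hx θ hθ μ
      rw [← mul_neg]
      refine hw.le_smoothLevi_convolution hW (fun y hy => hWw y (interior_subset hy)) hUA φ _ ?_ _ _
        (fun y hy => hL y hy μ)
      refine Subset.trans ?_ hδU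
      refine (Metric.closedBall_subset_closedBall (min_le_left _ _)).trans ?_
      have hxΓ : polarPoint a (t + α * x) (τ + β * x) θ ∈ Γ := ⟨(x, θ), ⟨hx, hθ⟩, rfl⟩
      exact Metric.closedBall_subset_cthickening hxΓ δ
    · intro x hx
      have hx' : ∀ θ ∈ Icc (0 : ℝ) (2 * Real.pi),
          polarPoint a (t + α * x) (τ + β * x) θ ∈ Γ := fun θ hθ => ⟨(x, θ), ⟨hx, hθ⟩, rfl⟩
      have hcx : Continuous fun θ => polarPoint a (t + α * x) (τ + β * x) θ :=
        hcurve.comp (Continuous.prodMk_right x)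
      have i1 : IntervalIntegrable (fun θ => u (polarPoint a (t + α * x) (τ + β * x) θ)) volume
          0 (2 * Real.pi) := (hsm.continuous.comp hcx).intervalIntegrable _ _
      have i2 : IntervalIntegrable (fun θ => w (polarPoint a (t + α * x) (τ + β * x) θ)) volume
          0 (2 * Real.pi) := by
        refine ContinuousOn.intervalIntegrable ?_
        rw [uIcc_of_le (by positivity)]
        exact hw.continuousOn.comp hcx.continuousOn
          fun θ hθ => interior_subset (hUA (hΓU (hx' θ hθ)))
      simp only [hf, add_sub_add_right_eq_sub]
      rw [← intervalIntegral.integral_sub i1 i2]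
      have hb := intervalIntegral.norm_integral_le_of_norm_le_const (a := 0) (b := 2 * Real.pi)
        (f := fun θ => u (polarPoint a (t + α * x) (τ + β * x) θ)
          - w (polarPoint a (t + α * x) (τ + β * x) θ)) (C := ε) ?_
      · rwa [sub_zero, abs_of_pos (by positivity : 0 < 2 * Real.pi), Real.norm_eq_abs] at hb
      intro θ hθ
      rw [uIoc_of_le (by positivity)] at hθ
      have hy := hx' θ ⟨hθ.1.le, hθ.2⟩
      rw [← hWw _ (interior_subset (hUA (hΓU hy))), ← dist_eq_norm]
      refine φ.dist_normed_convolution_le hW.aestronglyMeasurable fun y hy' => ?_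
      rw [dist_comm]
      have hlt : dist (polarPoint a (t + α * x) (τ + β * x) θ) y < δ' := by
        rw [dist_comm]
        exact (Metric.mem_ball.1 hy').trans_le (min_le_right _ _)
      exact (hunif hlt hy).le
  refine ⟨convex_Icc _ _, fun x hx y hy p q hp hq hpq => ?_⟩
  refine le_of_forall_pos_le_add fun ε hε => ?_
  have hpi := Real.pi_pos
  -- The error is then $\varepsilon/2$ at the intermediate point and a weighted average of
  -- $\varepsilon/2$ at the end points.
  obtain ⟨F, hF, hFf⟩ := happrox (ε / (4 * Real.pi)) (by positivity)
  have h1 := hF.2 hx hy hp hq hpq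
  have hz := convex_Icc (0 : ℝ) 1 hx hy hp hq hpq
  have hε' : ε / (4 * Real.pi) * (2 * Real.pi) = ε / 2 := by field_simp; norm_num
  rw [hε'] at hFf
  have a1 := abs_le.1 (hFf x hx)
  have a2 := abs_le.1 (hFf y hy)
  have a3 := abs_le.1 (hFf _ hz)
  simp only [smul_eq_mul] at h1 a3 ⊢
  nlinarith [mul_le_mul_of_nonneg_left a1.2 hp, mul_le_mul_of_nonneg_left a2.2 hq]

/-! ### Convex functions of one real variable. -/

/-- Contracting the points towards $T/2$ moves them inside without changing their affine relation.
-/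
theorem convexOn_Icc_of_convexOn_Ioo {f : ℝ → ℝ} {T : ℝ} (hT : 0 < T)
    (hf : ContinuousOn f (Icc 0 T)) (h : ConvexOn ℝ (Ioo 0 T) f) : ConvexOn ℝ (Icc 0 T) f := by
  refine ⟨convex_Icc _ _, fun x hx y hy p q hp hq hpq => ?_⟩
  have hmid : ∀ z ∈ Icc 0 T, ∀ ε ∈ Ioc (0 : ℝ) 1, (1 - ε) * z + ε * (T / 2) ∈ Ioo 0 T := by
    intro z hz ε hε
    constructor
    · nlinarith [mul_nonneg (sub_nonneg.2 hε.2) hz.1, mul_pos hε.1 hT]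
    · nlinarith [mul_nonneg (sub_nonneg.2 hε.2) (sub_nonneg.2 hz.2), mul_pos hε.1 hT]
  have hlim : ∀ z ∈ Icc 0 T, Tendsto (fun ε : ℝ => f ((1 - ε) * z + ε * (T / 2))) (𝓝[>] 0)
      (𝓝 (f z)) := by
    intro z hz
    refine (hf z hz).tendsto.comp (tendsto_nhdsWithin_iff.2 ⟨?_, ?_⟩)
    · have : Continuous fun ε : ℝ => (1 - ε) * z + ε * (T / 2) := by fun_prop
      exact (this.tendsto' 0 z (by simp)).mono_left nhdsWithin_le_nhds
    · filter_upwards [Ioc_mem_nhdsGT (zero_lt_one' ℝ)] with ε hε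
      exact Ioo_subset_Icc_self (hmid z hz ε hε)
  refine le_of_tendsto_of_tendsto (hlim _ (convex_Icc 0 T hx hy hp hq hpq))
    (((hlim x hx).const_smul p).add ((hlim y hy).const_smul q)) ?_
  filter_upwards [Ioc_mem_nhdsGT (zero_lt_one' ℝ)] with ε hε
  have := h.2 (hmid x hx ε hε) (hmid y hy ε hε) hp hq hpq
  convert this using 2
  simp only [smul_eq_mul]
  linear_combination (-(ε * (T / 2))) * hpq

/-- If `h · exp (lam t)` is convex for every `lam` and `h` vanishes at the right end point, then
`h` vanishes at the left one. -/
theorem nonpos_of_convexOn_mul_exp {h : ℝ → ℝ} {T : ℝ} (hT : 0 < T)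
    (hc : ContinuousOn h (Icc 0 T))
    (hconv : ∀ lam : ℝ, ConvexOn ℝ (Icc 0 T) fun t => h t * Real.exp (lam * t))
    (hhT : h T ≤ 0) : h 0 ≤ 0 := by
  have hin : ∀ t ∈ Ioo 0 T, h t ≤ 0 := by
    intro t ht
    by_contra! hpos
    -- Convexity between $0$ and $T$: the end point $T$ contributes a nonpositive term however large
    -- $\lambda$ is.
    have hle : ∀ lam : ℝ, h t * Real.exp (lam * t) ≤ |h 0| := by
      intro lam
      have h1 := (hconv lam).2 (left_mem_Icc.2 hT.le) (right_mem_Icc.2 hT.le)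
        (show 0 ≤ 1 - t / T by rw [sub_nonneg, div_le_one hT]; exact ht.2.le)
        (show 0 ≤ t / T from div_nonneg ht.1.le hT.le) (by ring)
      have e : (1 - t / T) • (0 : ℝ) + (t / T) • T = t := by
        simp only [smul_eq_mul]; field_simp; ring
      simp only [e] at h1
      have h2 : h T * Real.exp (lam * T) ≤ 0 :=
        mul_nonpos_of_nonpos_of_nonneg hhT (Real.exp_pos _).le
      have h3 : 0 ≤ t / T := div_nonneg ht.1.le hT.le
      have h4 : t / T ≤ 1 := (div_le_one hT).2 ht.2.le
      simp only [mul_zero, Real.exp_zero, mul_one, smul_eq_mul] at h1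
      nlinarith [le_abs_self (h 0), abs_nonneg (h 0), mul_nonneg h3 (abs_nonneg (h 0)),
        mul_nonneg h3 (neg_nonneg.2 h2),
        mul_nonneg (sub_nonneg.2 h4) (sub_nonneg.2 (le_abs_self (h 0)))]
    -- This $\lambda$ makes $e^{\lambda t}\ge1+|h(0)|/h(t)$, so the left side exceeds $|h(0)|$.
    have ht1 := hle ((|h 0| / h t) / t)
    rw [div_mul_cancel₀ _ ht.1.ne'] at ht1
    have h5 := Real.add_one_le_exp (|h 0| / h t)
    have h6 : h t * (|h 0| / h t + 1) = |h 0| + h t := by field_simp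
    nlinarith
  have hlim : Tendsto h (𝓝[Ioo 0 T] 0) (𝓝 (h 0)) :=
    (hc 0 (left_mem_Icc.2 hT.le)).mono Ioo_subset_Icc_self
  have : (𝓝[Ioo 0 T] (0 : ℝ)).NeBot := by
    rw [← mem_closure_iff_nhdsWithin_neBot, closure_Ioo hT.ne]
    exact left_mem_Icc.2 hT.le
  exact le_of_tendsto hlim (eventually_nhdsWithin_of_forall hin)

/-- On a half line extending to `-∞`, a convex function with a limit at `-∞` lies above it. -/
theorem le_of_convex_of_tendsto_atBot {g : ℝ → ℝ} {l τ₁ : ℝ} (hl : Tendsto g atBot (𝓝 l))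
    (hg : ∀ τ < τ₁, ConvexOn ℝ (Icc (0 : ℝ) 1) fun x => g (τ + (τ₁ - τ) * x)) : l ≤ g τ₁ := by
  have hinv : Tendsto (fun j : ℝ => 1 / j) atTop (𝓝 0) := by
    simpa using tendsto_inv_atTop_zero (𝕜 := ℝ)
  have t1 : Tendsto (fun j : ℝ => τ₁ - j) atTop atBot := by
    simpa [sub_eq_add_neg] using
      tendsto_atBot_add_const_left atTop τ₁ tendsto_neg_atTop_atBot
  -- The point $\tau_1-j$ is the combination of $\tau_1-j^2$ and $\tau_1$ with weights $1/j$ and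
  -- $1-1/j$. The far value is bounded, so its contribution disappears as $j\to\infty$.
  have t2 : Tendsto (fun j : ℝ => τ₁ - j ^ 2) atTop atBot :=
    t1.comp (tendsto_pow_atTop (n := 2) (by norm_num))
  have r : Tendsto (fun j : ℝ => (1 / j) * g (τ₁ - j ^ 2) + (1 - 1 / j) * g τ₁) atTop
      (𝓝 (0 * l + (1 - 0) * g τ₁)) :=
    (hinv.mul (hl.comp t2)).add ((hinv.const_sub 1).mul_const _)
  rw [zero_mul, zero_add, sub_zero, one_mul] at r
  refine le_of_tendsto_of_tendsto (hl.comp t1) r ?_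
  filter_upwards [eventually_ge_atTop 1] with j hj
  have hj0 : 0 < j := by linarith
  have h1 := (hg (τ₁ - j ^ 2) (by nlinarith)).2 (left_mem_Icc.2 zero_le_one)
    (right_mem_Icc.2 zero_le_one) (show 0 ≤ 1 / j by positivity)
    (show 0 ≤ 1 - 1 / j by rw [sub_nonneg, div_le_one hj0]; exact hj) (by ring)
  have e1 : τ₁ - j ^ 2 + (τ₁ - (τ₁ - j ^ 2)) * (1 / j * 0 + (1 - 1 / j) * 1) = τ₁ - j := by
    field_simp; ring
  have e2 : τ₁ - j ^ 2 + (τ₁ - (τ₁ - j ^ 2)) * 1 = τ₁ := by ring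
  have e3 : τ₁ - j ^ 2 + (τ₁ - (τ₁ - j ^ 2)) * 0 = τ₁ - j ^ 2 := by ring
  simp only [e1, e2, e3, smul_eq_mul] at h1
  exact h1

/-! ### Circular means near the axis, and their convexity. -/

theorem tendsto_intervalIntegral_of_mem_compact {M ι : Type*} [TopologicalSpace M] {w : M → ℝ}
    {K : Set M} (hK : IsCompact K) (hw : ContinuousOn w K) {l : Filter ι} [l.IsCountablyGenerated]
    {P : ι → ℝ → M} {Q : ℝ → M} {b c : ℝ} (hPc : ∀ᶠ i in l, Continuous (P i))
    (hP : ∀ᶠ i in l, ∀ θ, P i θ ∈ K) (hQ : ∀ θ, Q θ ∈ K)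
    (hlim : ∀ θ, Tendsto (fun i => P i θ) l (𝓝 (Q θ))) :
    Tendsto (fun i => ∫ θ in b..c, w (P i θ)) l (𝓝 (∫ θ in b..c, w (Q θ))) := by
  obtain ⟨C, hC⟩ := hK.exists_bound_of_continuousOn hw
  refine intervalIntegral.tendsto_integral_filter_of_dominated_convergence (fun _ => C) ?_ ?_
    intervalIntegrable_const ?_
  · filter_upwards [hPc, hP] with i h1 h2
    exact (hw.comp_continuous h1 h2).aestronglyMeasurable
  · filter_upwards [hP] with i h2
    exact Eventually.of_forall fun θ _ => hC _ (h2 θ)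
  · refine Eventually.of_forall fun θ _ => ?_
    exact (hw _ (hQ θ)).tendsto.comp
      (tendsto_nhdsWithin_iff.2 ⟨hlim θ, hP.mono fun i h => h θ⟩)

theorem norm_polarPoint_snd (a : Fin m → ℂ) (t τ θ : ℝ) :
    ‖(polarPoint a t τ θ).2‖ = Real.exp τ * ‖a‖ := by
  simp [polarPoint, norm_smul, norm_exp]

theorem mem_interior_closedStrip_prod {R : ℝ} {y : ℂ × (Fin m → ℂ)} (h0 : 0 < y.1.im)
    (h1 : y.1.im < 1) (h2 : ‖y.2‖ < R) :
    y ∈ interior (closedStrip ×ˢ Metric.closedBall (0 : Fin m → ℂ) R) := by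
  rw [interior_prod_eq]
  refine ⟨?_, Metric.ball_subset_interior_closedBall (by simpa using h2)⟩
  have hopen : IsOpen {s : ℂ | 0 < s.im ∧ s.im < 1} :=
    (isOpen_lt continuous_const continuous_im).inter (isOpen_lt continuous_im continuous_const)
  have hsub : {s : ℂ | 0 < s.im ∧ s.im < 1} ⊆ closedStrip := fun s hs => ⟨hs.1.le, hs.2.le⟩
  exact interior_maximal hsub hopen ⟨h0, h1⟩

theorem HasDdbar.neg {w : ℂ × (Fin m → ℂ) → ℝ}
    {c : ℂ × (Fin m → ℂ) → Matrix (Idx m) (Idx m) ℂ} {A : Set (ℂ × (Fin m → ℂ))}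
    (hw : HasDdbar w c A) : HasDdbar (fun y => -w y) (fun y => -c y) A where
  continuousOn := hw.continuousOn.neg
  continuousOn_coeff := hw.continuousOn_coeff.neg
  weak χ h1 h2 h3 p q := by
    simp only [ofReal_neg, neg_mul, Matrix.neg_apply, integral_neg, hw.weak χ h1 h2 h3 p q]

theorem HasDdbar.mono {w : ℂ × (Fin m → ℂ) → ℝ}
    {c : ℂ × (Fin m → ℂ) → Matrix (Idx m) (Idx m) ℂ} {A B : Set (ℂ × (Fin m → ℂ))}
    (hw : HasDdbar w c A) (hBA : B ⊆ A) : HasDdbar w c B where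
  continuousOn := hw.continuousOn.mono hBA
  continuousOn_coeff := hw.continuousOn_coeff.mono hBA
  weak χ h1 h2 h3 p q := hw.weak χ h1 h2 (h3.trans (interior_mono hBA)) p q

theorem levi_neg (c : Matrix (Idx m) (Idx m) ℂ) (ξ : ℂ × (Fin m → ℂ)) :
    levi (-c) ξ = -levi c ξ := by
  simp [-Fintype.sum_sum_type, levi]

theorem levi_zero_smul (c : Matrix (Idx m) (Idx m) ℂ) (a : Fin m → ℂ) (μ : ℂ) :
    (levi c (0, μ • a)).re = ‖μ‖ ^ 2 * (levi c (0, a)).re := by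
  have h : levi c (0, μ • a) = ((‖μ‖ ^ 2 : ℝ) : ℂ) * levi c (0, a) := by
    have hd : ∀ p, dcoord p ((0 : ℂ), μ • a) = μ * dcoord p ((0 : ℂ), a) := by
      intro p
      rcases p with p | p <;> simp [dcoord]
    have hμ : ((‖μ‖ ^ 2 : ℝ) : ℂ) = μ * star μ := by
      rw [RCLike.star_def, mul_conj, normSq_eq_norm_sq]
    simp only [levi, hd, hμ, Finset.mul_sum, star_mul']
    exact Finset.sum_congr rfl fun p _ => Finset.sum_congr rfl fun q _ => by ring
  rw [h, re_ofReal_mul]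

theorem continuous_axis : Continuous fun t : ℝ => (((I * t : ℂ), 0) : ℂ × (Fin m → ℂ)) := by
  fun_prop

theorem axis_mem {R t : ℝ} (hR : 0 ≤ R) (ht : t ∈ Icc (0 : ℝ) 1) :
    (((I * t : ℂ), 0) : ℂ × (Fin m → ℂ)) ∈ closedStrip ×ˢ Metric.closedBall 0 R := by
  refine ⟨?_, by simpa using hR⟩
  simpa [closedStrip] using ht

/-- The closed strip is not compact, but the circular means only see imaginary $s$; this gives the
uniform bounds for dominated convergence. -/
theorem isCompact_axis_prod (R : ℝ) : IsCompact
    (((fun t : ℝ => (I * t : ℂ)) '' Icc 0 1) ×ˢ Metric.closedBall (0 : Fin m → ℂ) R) :=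
  (isCompact_Icc.image (by fun_prop)).prod (isCompact_closedBall _ _)

theorem axis_prod_subset (R : ℝ) :
    (((fun t : ℝ => (I * t : ℂ)) '' Icc 0 1) ×ˢ Metric.closedBall (0 : Fin m → ℂ) R)
      ⊆ closedStrip ×ˢ Metric.closedBall (0 : Fin m → ℂ) R := by
  rintro ⟨_, z⟩ ⟨⟨t, ht, rfl⟩, hz⟩
  exact ⟨by simpa [closedStrip] using ht, hz⟩

section Means

variable {w : ℂ × (Fin m → ℂ) → ℝ} {c : ℂ × (Fin m → ℂ) → Matrix (Idx m) (Idx m) ℂ} {R : ℝ}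

theorem tendsto_circleMean_atBot
    (hw : ContinuousOn w (closedStrip ×ˢ Metric.closedBall (0 : Fin m → ℂ) R)) (hR : 0 < R)
    (a : Fin m → ℂ) {t : ℝ} (ht : t ∈ Icc (0 : ℝ) 1) :
    Tendsto (fun τ => ∫ θ in (0 : ℝ)..(2 * Real.pi), w (polarPoint a t τ θ)) atBot
      (𝓝 (2 * Real.pi * w (I * t, 0))) := by
  have hexp : Tendsto (fun τ => Real.exp τ * ‖a‖) atBot (𝓝 0) := by
    simpa using Real.tendsto_exp_atBot.mul_const ‖a‖
  have h := tendsto_intervalIntegral_of_mem_compact (isCompact_axis_prod R)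
    (hw.mono (axis_prod_subset R)) (l := atBot) (P := fun τ θ => polarPoint a t τ θ)
    (Q := fun _ => (I * t, 0)) (b := 0) (c := 2 * Real.pi)
    (Eventually.of_forall fun τ => (continuous_polarPoint a).comp
      (by fun_prop : Continuous fun θ : ℝ => (t, τ, θ))) ?_
    (fun θ => ⟨⟨t, ht, rfl⟩, by simpa using hR.le⟩) ?_
  · simpa using h
  · filter_upwards [hexp.eventually (gt_mem_nhds hR)] with τ hτ θ
    refine ⟨⟨t, ht, rfl⟩, ?_⟩
    rw [mem_closedBall_zero_iff, norm_polarPoint_snd]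
    exact hτ.le
  · intro θ
    refine tendsto_const_nhds.prodMk_nhds ?_
    rw [tendsto_zero_iff_norm_tendsto_zero]
    refine hexp.congr fun τ => ?_
    exact (norm_polarPoint_snd a t τ θ).symm

/-- The sub-mean value inequality on small discs in the slice `s = i t`. -/
theorem HasDdbar.le_circleMean
    (hw : HasDdbar w c (closedStrip ×ˢ Metric.closedBall 0 R)) (hR : 0 < R)
    (hinv : ∀ s ∈ closedStrip, ∀ z ∈ Metric.closedBall (0 : Fin m → ℂ) R, ∀ σ : ℝ,
      w (s + σ, z) = w (s, z))
    (a : Fin m → ℂ) {t τ₁ κ : ℝ} (ht : t ∈ Icc (0 : ℝ) 1) {U : Set (ℂ × (Fin m → ℂ))}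
    (hU : IsOpen U) (hUA : U ⊆ interior (closedStrip ×ˢ Metric.closedBall 0 R))
    (hP : ∀ τ ≤ τ₁, ∀ θ, polarPoint a t τ θ ∈ U) (hL : ∀ y ∈ U, κ ≤ (levi (c y) (0, a)).re) :
    2 * Real.pi * (w (I * t, 0) + κ * Real.exp (2 * τ₁))
      ≤ ∫ θ in (0 : ℝ)..(2 * Real.pi), w (polarPoint a t τ₁ θ) := by
  -- The mean minus $2\pi\kappa e^{2\tau}$ is convex in $\tau$ and has this limit at $-\infty$, so
  -- it stays above the limit.
  have hlim : Tendsto (fun τ => (∫ θ in (0 : ℝ)..(2 * Real.pi), w (polarPoint a t τ θ))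
      + 2 * Real.pi * (-κ * Real.exp (2 * τ))) atBot (𝓝 (2 * Real.pi * w (I * t, 0))) := by
    have h1 : Tendsto (fun τ => Real.exp (2 * τ)) atBot (𝓝 0) :=
      Real.tendsto_exp_atBot.comp (tendsto_id.const_mul_atBot (by norm_num))
    simpa using (tendsto_circleMean_atBot hw.continuousOn hR a ht).add
      ((h1.const_mul (-κ)).const_mul (2 * Real.pi))
  have := le_of_convex_of_tendsto_atBot (τ₁ := τ₁) hlim fun τ hτ => ?_
  · linarith
  have h2 := hw.convexOn_circleMean hinv a t τ 0 (τ₁ - τ) (-κ) 0 hU hUA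
    (fun x hx θ _ => ?_) (fun y hy μ => ?_)
  · simpa using h2
  · rw [zero_mul, add_zero]
    exact hP _ (by nlinarith [hx.2]) θ
  · rw [ofReal_zero, levi_zero_smul]
    nlinarith [mul_le_mul_of_nonneg_left (hL y hy) (sq_nonneg ‖μ‖)]

/-- The one-sided estimate is applied to both $w$ and $-w$. -/
theorem HasDdbar.abs_circleMean_sub_le
    (hw : HasDdbar w c (closedStrip ×ˢ Metric.closedBall 0 R)) (hR : 0 < R)
    (hinv : ∀ s ∈ closedStrip, ∀ z ∈ Metric.closedBall (0 : Fin m → ℂ) R, ∀ σ : ℝ,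
      w (s + σ, z) = w (s, z))
    (a : Fin m → ℂ) {t τ₁ κ η : ℝ} (ht : t ∈ Icc (0 : ℝ) 1) {U : Set (ℂ × (Fin m → ℂ))}
    (hU : IsOpen U) (hUA : U ⊆ interior (closedStrip ×ˢ Metric.closedBall 0 R))
    (hP : ∀ τ ≤ τ₁, ∀ θ, polarPoint a t τ θ ∈ U)
    (hL : ∀ y ∈ U, |(levi (c y) (0, a)).re - κ| ≤ η) :
    |(∫ θ in (0 : ℝ)..(2 * Real.pi), w (polarPoint a t τ₁ θ))
      - 2 * Real.pi * (w (I * t, 0) + κ * Real.exp (2 * τ₁))|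
      ≤ 2 * Real.pi * (η * Real.exp (2 * τ₁)) := by
  have h1 := hw.le_circleMean hR hinv a (κ := κ - η) ht hU hUA hP
    (fun y hy => by linarith [(abs_le.1 (hL y hy)).1])
  have h2 := hw.neg.le_circleMean hR (fun s hs z hz σ => by rw [hinv s hs z hz σ]) a
    (κ := -(κ + η)) ht hU hUA hP
    (fun y hy => by rw [levi_neg, neg_re]; linarith [(abs_le.1 (hL y hy)).2])
  rw [intervalIntegral.integral_neg] at h2
  rw [abs_le]
  constructor <;> linarith

/-- A second-order Taylor expansion of the mean, although $w$ need not be twice differentiable: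
continuity of the coefficients pins the Levi form near $\kappa$ on small discs. -/
theorem HasDdbar.tendsto_circleMean_sub
    (hw : HasDdbar w c (closedStrip ×ˢ Metric.closedBall 0 R)) (hR : 0 < R)
    (hinv : ∀ s ∈ closedStrip, ∀ z ∈ Metric.closedBall (0 : Fin m → ℂ) R, ∀ σ : ℝ,
      w (s + σ, z) = w (s, z))
    (a : Fin m → ℂ) {t : ℝ} (ht : t ∈ Ioo (0 : ℝ) 1) :
    Tendsto (fun τ => ((∫ θ in (0 : ℝ)..(2 * Real.pi), w (polarPoint a t τ θ))
      - 2 * Real.pi * w (I * t, 0)) * Real.exp (-(2 * τ))) atBot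
      (𝓝 (2 * Real.pi * (levi (c (I * t, 0)) (0, a)).re)) := by
  set κ := (levi (c (I * t, 0)) (0, a)).re with hκ
  have hmem : (((I * t : ℂ), 0) : ℂ × (Fin m → ℂ))
      ∈ interior (closedStrip ×ˢ Metric.closedBall 0 R) :=
    mem_interior_closedStrip_prod (by simpa using ht.1) (by simpa using ht.2) (by simpa using hR)
  have hcont : ContinuousAt (fun y => (levi (c y) (0, a)).re) (I * t, 0) :=
    (continuous_re.comp (continuous_levi _)).continuousAt.comp
      (hw.continuousOn_coeff.continuousAt (mem_interior_iff_mem_nhds.1 hmem))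
  have hexp : Tendsto (fun τ => Real.exp τ * ‖a‖) atBot (𝓝 0) := by
    simpa using Real.tendsto_exp_atBot.mul_const ‖a‖
  rw [Metric.tendsto_nhds]
  intro ε hε
  have hpi := Real.pi_pos
  set η := ε / (4 * Real.pi) with hη
  have hη0 : 0 < η := by positivity
  have hnear : ∀ᶠ y in 𝓝 (((I * t : ℂ), 0) : ℂ × (Fin m → ℂ)),
      y ∈ interior (closedStrip ×ˢ Metric.closedBall 0 R) ∧
        |(levi (c y) (0, a)).re - κ| ≤ η := by
    filter_upwards [isOpen_interior.mem_nhds hmem,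
      hcont.eventually (Metric.closedBall_mem_nhds _ hη0)] with y h1 h2
    exact ⟨h1, by simpa [Real.dist_eq] using h2⟩
  obtain ⟨δ, hδ, hball⟩ := Metric.eventually_nhds_iff_ball.1 hnear
  filter_upwards [hexp.eventually (gt_mem_nhds hδ)] with τ hτ
  have h := hw.abs_circleMean_sub_le hR hinv a (τ₁ := τ) (κ := κ) (η := η) ⟨ht.1.le, ht.2.le⟩
    (Metric.isOpen_ball (x := (((I * t : ℂ), 0) : ℂ × (Fin m → ℂ))) (ε := δ))
    (fun y hy => (hball y hy).1) (fun τ' hτ' θ => ?_) (fun y hy => (hball y hy).2)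
  · rw [Real.dist_eq]
    have e : ((∫ θ in (0 : ℝ)..(2 * Real.pi), w (polarPoint a t τ θ))
      - 2 * Real.pi * w (I * t, 0)) * Real.exp (-(2 * τ)) - 2 * Real.pi * κ
      = ((∫ θ in (0 : ℝ)..(2 * Real.pi), w (polarPoint a t τ θ))
      - 2 * Real.pi * (w (I * t, 0) + κ * Real.exp (2 * τ))) * Real.exp (-(2 * τ)) := by
      rw [Real.exp_neg]
      field_simp
      ring
    rw [e, abs_mul, abs_of_pos (Real.exp_pos _)]
    have h3 := mul_le_mul_of_nonneg_right h (Real.exp_pos (-(2 * τ))).le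
    have e2 : 2 * Real.pi * (η * Real.exp (2 * τ)) * Real.exp (-(2 * τ)) = ε / 2 := by
      rw [Real.exp_neg, hη]
      field_simp
      norm_num
    rw [e2] at h3
    linarith
  · rw [Metric.mem_ball, Prod.dist_eq]
    refine max_lt (by simpa [polarPoint] using hδ) ?_
    rw [dist_zero_right, norm_polarPoint_snd]
    exact (mul_le_mul_of_nonneg_right (Real.exp_le_exp.2 hτ') (norm_nonneg a)).trans_lt hτ

/-- Where `w` vanishes for real `s`, so do the tangential coefficients of `∂∂bar w`. -/
theorem HasDdbar.levi_eq_zero_of_boundary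
    (hw : HasDdbar w c (closedStrip ×ˢ Metric.closedBall 0 R)) (hR : 0 < R)
    (hinv : ∀ s ∈ closedStrip, ∀ z ∈ Metric.closedBall (0 : Fin m → ℂ) R, ∀ σ : ℝ,
      w (s + σ, z) = w (s, z))
    (h0 : ∀ z ∈ Metric.closedBall (0 : Fin m → ℂ) R, w (0, z) = 0) (a : Fin m → ℂ) :
    (levi (c 0) (0, a)).re = 0 := by
  set κ := (levi (c 0) (0, a)).re with hκ
  have hmem : (0 : ℂ × (Fin m → ℂ)) ∈ closedStrip ×ˢ Metric.closedBall (0 : Fin m → ℂ) R := by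
    simpa using axis_mem (m := m) hR.le (left_mem_Icc.2 zero_le_one)
  have hcont : ContinuousWithinAt (fun y => (levi (c y) (0, a)).re)
      (closedStrip ×ˢ Metric.closedBall 0 R) 0 :=
    (continuous_re.comp (continuous_levi _)).continuousAt.comp_continuousWithinAt
      (hw.continuousOn_coeff 0 hmem)
  have hexp : Tendsto (fun τ => Real.exp τ * ‖a‖) atBot (𝓝 0) := by
    simpa using Real.tendsto_exp_atBot.mul_const ‖a‖
  rw [← abs_eq_zero]
  refine le_antisymm (le_of_forall_pos_le_add fun η hη => ?_) (abs_nonneg _)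
  rw [zero_add]
  obtain ⟨δ, hδ, hball⟩ := Metric.continuousWithinAt_iff.1 hcont η hη
  obtain ⟨τ, hτR, hτδ⟩ := ((hexp.eventually (gt_mem_nhds hR)).and
    (hexp.eventually (gt_mem_nhds hδ))).exists
  have hmemK : ∀ {t : ℝ}, t ∈ Icc (0 : ℝ) 1 → ∀ θ, polarPoint a t τ θ ∈
      ((fun t : ℝ => (I * t : ℂ)) '' Icc 0 1) ×ˢ Metric.closedBall (0 : Fin m → ℂ) R := by
    intro t ht θ
    refine ⟨⟨t, ht, rfl⟩, ?_⟩
    rw [mem_closedBall_zero_iff, norm_polarPoint_snd]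
    exact hτR.le
  -- The weak identity holds only in the interior, so the mean value estimate is used at height
  -- $t>0$ with the radius fixed. As $t\to0$ the mean and the axis value vanish, leaving
  -- $|\kappa|\le\eta$.
  have hbound : ∀ᶠ t : ℝ in 𝓝[>] 0,
      |(∫ θ in (0 : ℝ)..(2 * Real.pi), w (polarPoint a t τ θ))
      - 2 * Real.pi * (w (I * t, 0) + κ * Real.exp (2 * τ))|
      ≤ 2 * Real.pi * (η * Real.exp (2 * τ)) := by
    filter_upwards [Ioo_mem_nhdsGT (lt_min hδ zero_lt_one)] with t ht
    have ht1 : t < 1 := ht.2.trans_le (min_le_right _ _)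
    refine hw.abs_circleMean_sub_le hR hinv a ⟨ht.1.le, ht1.le⟩
      (isOpen_interior.inter (Metric.isOpen_ball (x := 0) (ε := δ))) inter_subset_left ?_ ?_
    · intro τ' hτ' θ
      have hle : ‖(polarPoint a t τ' θ).2‖ ≤ Real.exp τ * ‖a‖ := by
        rw [norm_polarPoint_snd]
        exact mul_le_mul_of_nonneg_right (Real.exp_le_exp.2 hτ') (norm_nonneg a)
      refine ⟨mem_interior_closedStrip_prod (by simpa [polarPoint] using ht.1)
        (by simpa [polarPoint] using ht1) (hle.trans_lt hτR), ?_⟩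
      rw [mem_ball_zero_iff, Prod.norm_def]
      refine max_lt ?_ (hle.trans_lt hτδ)
      simpa [polarPoint, abs_of_pos ht.1] using ht.2.trans_le (min_le_left _ _)
    · intro y hy
      exact (hball (interior_subset hy.1) hy.2).le
  have l1 : Tendsto (fun t : ℝ => ∫ θ in (0 : ℝ)..(2 * Real.pi), w (polarPoint a t τ θ)) (𝓝[>] 0)
      (𝓝 (∫ θ in (0 : ℝ)..(2 * Real.pi), w (polarPoint a 0 τ θ))) := by
    refine tendsto_intervalIntegral_of_mem_compact (isCompact_axis_prod R)
      (hw.continuousOn.mono (axis_prod_subset R)) (P := fun t θ => polarPoint a t τ θ)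
      (Eventually.of_forall fun t => (continuous_polarPoint a).comp
      (by fun_prop : Continuous fun θ : ℝ => (t, τ, θ))) ?_
      (fun θ => hmemK (left_mem_Icc.2 zero_le_one) θ) ?_
    · filter_upwards [Ioo_mem_nhdsGT (zero_lt_one' ℝ)] with t ht
      exact hmemK ⟨ht.1.le, ht.2.le⟩
    · intro θ
      exact (((continuous_polarPoint a).comp (by fun_prop : Continuous fun t : ℝ => (t, τ, θ))).tendsto
        0).mono_left nhdsWithin_le_nhds
  have l2 : Tendsto (fun t : ℝ => w (I * t, 0)) (𝓝[>] 0) (𝓝 (w (I * (0 : ℝ), 0))) := by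
    refine (hw.continuousOn _ (axis_mem hR.le (left_mem_Icc.2 zero_le_one))).tendsto.comp
      (tendsto_nhdsWithin_iff.2 ⟨(continuous_axis.tendsto 0).mono_left nhdsWithin_le_nhds, ?_⟩)
    filter_upwards [Ioo_mem_nhdsGT (zero_lt_one' ℝ)] with t ht
    exact axis_mem hR.le ⟨ht.1.le, ht.2.le⟩
  have e1 : ∀ θ, w (polarPoint a 0 τ θ) = 0 := by
    intro θ
    have := h0 (polarPoint a 0 τ θ).2 (hmemK (left_mem_Icc.2 zero_le_one) θ).2
    refine Eq.trans ?_ this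
    simp [polarPoint]
  have e2 : w (I * (0 : ℝ), 0) = 0 := by
    simpa using h0 0 (by simpa using hR.le)
  simp only [e1, intervalIntegral.integral_zero] at l1
  rw [e2] at l2
  have l3 := (l1.sub ((l2.add_const (κ * Real.exp (2 * τ))).const_mul (2 * Real.pi))).abs
  have l4 := le_of_tendsto l3 hbound
  have hpos : 0 < 2 * Real.pi * Real.exp (2 * τ) :=
    mul_pos (by linarith [Real.pi_pos]) (Real.exp_pos _)
  rw [zero_add, zero_sub, abs_neg, show 2 * Real.pi * (κ * Real.exp (2 * τ))
    = κ * (2 * Real.pi * Real.exp (2 * τ)) by ring, abs_mul, abs_of_pos hpos] at l4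
  refine le_of_mul_le_mul_right ?_ hpos
  linarith

/-- If the `ds ∧ d\bar s` coefficient vanishes along the axis, `w` is affine along it. -/
theorem HasDdbar.convexOn_axis
    (hw : HasDdbar w c (closedStrip ×ˢ Metric.closedBall 0 R)) (hR : 0 < R)
    (hinv : ∀ s ∈ closedStrip, ∀ z ∈ Metric.closedBall (0 : Fin m → ℂ) R, ∀ σ : ℝ,
      w (s + σ, z) = w (s, z))
    {T : ℝ} (hT : T ≤ 1)
    (h0 : ∀ t ∈ Ioo 0 T, (levi (c (I * t, 0)) (1, 0)).re = 0) :
    ConvexOn ℝ (Ioo 0 T) fun t : ℝ => w (I * t, 0) := by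
  have hpi := Real.pi_pos
  refine ⟨convex_Ioo _ _, fun t₀ ht₀ t₁ ht₁ p q hp hq hpq => ?_⟩
  refine le_of_forall_pos_le_add fun ε hε => ?_
  have hcw : ∀ {α : ℝ} (c : Matrix (Idx m) (Idx m) ℂ),
      (levi c ((α : ℂ), 0)).re = α ^ 2 * (levi c (1, 0)).re := by
    intro α c
    have : levi c ((α : ℂ), 0) = ((α ^ 2 : ℝ) : ℂ) * levi c (1, 0) := by
      have hd : ∀ p, dcoord (m := m) p ((α : ℂ), 0) = α * dcoord p (1, 0) := by
        intro p
        rcases p with p | p <;> simp [dcoord]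
      simp only [levi, hd, Finset.mul_sum, star_mul', RCLike.star_def, conj_ofReal]
      refine Finset.sum_congr rfl fun p _ => Finset.sum_congr rfl fun q _ => ?_
      push_cast
      ring
    rw [this, re_ofReal_mul]
  have hcont : ContinuousOn (fun y => (levi (c y) (1, 0)).re)
      (interior (closedStrip ×ˢ Metric.closedBall 0 R)) :=
    (continuous_re.comp (continuous_levi _)).comp_continuousOn
      (hw.continuousOn_coeff.mono interior_subset)
  set η := ε / 2 with hη
  have hη0 : 0 < η := by positivity
  have hopen := hcont.isOpen_inter_preimage isOpen_interior (isOpen_Ioi (a := -η))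
  have hx : ∀ x ∈ Icc (0 : ℝ) 1, t₀ + (t₁ - t₀) * x ∈ Ioo 0 T := by
    intro x hx
    have := convex_Ioo 0 T ht₀ ht₁ (sub_nonneg.2 hx.2) hx.1 (by ring)
    convert this using 1
    simp only [smul_eq_mul]; ring
  -- Circles of radius zero, with $K=0$ and $K'=\eta$: the Levi form in the $s$-direction exceeds
  -- $-\eta$ near the axis. The correction $2\eta t^2$ is at most $2\eta=\varepsilon$.
  have h := hw.convexOn_circleMean hinv 0 t₀ 0 (t₁ - t₀) 0 0 η hopen inter_subset_left
    (fun x hx' θ _ => ?_) (fun y hy μ => ?_)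
  · have h1 := h.2 (left_mem_Icc.2 zero_le_one) (right_mem_Icc.2 zero_le_one) hp hq hpq
    have e : t₀ + (t₁ - t₀) * q = p * t₀ + q * t₁ := by
      linear_combination (-t₀) * hpq
    simp only [polarPoint, smul_zero, intervalIntegral.integral_const, smul_eq_mul, mul_zero,
      mul_one, zero_add, add_zero, sub_zero, add_sub_cancel, e, zero_mul] at h1 ⊢
    have h2 : w (I * ((p * t₀ + q * t₁ : ℝ) : ℂ), 0) + 2 * η * (p * t₀ + q * t₁) ^ 2
        ≤ p * (w (I * t₀, 0) + 2 * η * t₀ ^ 2) + q * (w (I * t₁, 0) + 2 * η * t₁ ^ 2) := by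
      have h2pi : 0 < 2 * Real.pi := by positivity
      refine le_of_mul_le_mul_left ?_ h2pi
      linarith
    have b0 : t₀ ^ 2 ≤ 1 := by nlinarith [ht₀.1, ht₀.2]
    have b1 : t₁ ^ 2 ≤ 1 := by nlinarith [ht₁.1, ht₁.2]
    have b2 : p * t₀ ^ 2 + q * t₁ ^ 2 ≤ 1 := by nlinarith
    nlinarith [sq_nonneg (p * t₀ + q * t₁), mul_le_mul_of_nonneg_left b2 hη0.le,
      mul_nonneg hη0.le (sq_nonneg (p * t₀ + q * t₁))]
  · have ht := hx x hx'
    have hpp : polarPoint (0 : Fin m → ℂ) (t₀ + (t₁ - t₀) * x) (0 + 0 * x) θ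
        = (I * ((t₀ + (t₁ - t₀) * x : ℝ) : ℂ), 0) := by
      simp [polarPoint]
    rw [hpp]
    refine ⟨mem_interior_closedStrip_prod (by simpa using ht.1)
      (by simpa using ht.2.trans_le hT) (by simpa using hR), ?_⟩
    rw [mem_preimage, h0 _ ht]
    simpa using hη0
  · rw [smul_zero, hcw]
    have := hy.2
    rw [mem_preimage, mem_Ioi] at this
    nlinarith [mul_le_mul_of_nonneg_left this.le (sq_nonneg (t₁ - t₀))]

/-- Along a part of the axis where `w` is affine, the fiberwise Levi form in a fixed direction,
corrected by a bound for the background form, is logarithmically convex. -/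
theorem HasDdbar.convexOn_levi_mul_exp
    (hw : HasDdbar w c (closedStrip ×ˢ Metric.closedBall 0 R)) (hR : 0 < R)
    (hinv : ∀ s ∈ closedStrip, ∀ z ∈ Metric.closedBall (0 : Fin m → ℂ) R, ∀ σ : ℝ,
      w (s + σ, z) = w (s, z))
    {T : ℝ} (hT : T ≤ 1) (haff : ConcaveOn ℝ (Ioo 0 T) fun t : ℝ => w (I * t, 0))
    (a : Fin m → ℂ) (K : ℝ)
    (hL : ∀ y ∈ interior (closedStrip ×ˢ Metric.closedBall (0 : Fin m → ℂ) R), ∀ (α : ℝ) (μ : ℂ),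
      -(K * ‖μ‖ ^ 2) ≤ (levi (c y) ((α : ℂ), μ • a)).re) (lam : ℝ) :
    ConvexOn ℝ (Ioo 0 T) fun t : ℝ =>
      (K + (levi (c (I * t, 0)) (0, a)).re) * Real.exp (lam * t) := by
  refine ⟨convex_Ioo _ _, fun t₀ ht₀ t₁ ht₁ p q hp hq hpq => ?_⟩
  set t := p • t₀ + q • t₁ with ht
  have htm : t ∈ Ioo 0 T := convex_Ioo 0 T ht₀ ht₁ hp hq hpq
  have hexp : Tendsto (fun τ => Real.exp τ * ‖a‖) atBot (𝓝 0) := by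
    simpa using Real.tendsto_exp_atBot.mul_const ‖a‖
  set n : ℝ → ℝ → ℝ := fun t τ =>
    (∫ θ in (0 : ℝ)..(2 * Real.pi), w (polarPoint a t τ θ)) - 2 * Real.pi * w (I * t, 0) with hn
  have hlin : ∀ t : ℝ, Tendsto (fun ρ : ℝ => ρ + lam / 2 * t) atBot atBot := fun t =>
    tendsto_atBot_add_const_right _ _ tendsto_id
  -- On the line $\tau=\rho+\lambda t/2$ one has $e^{2\tau}=e^{2\rho}e^{\lambda t}$, so
  -- multiplication by $e^{-2\rho}$, independent of $t$, isolates the desired function as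
  -- $\rho\to-\infty$.
  have hlim : ∀ t ∈ Ioo 0 T, Tendsto
      (fun ρ => (n t (ρ + lam / 2 * t) + 2 * Real.pi * (K * Real.exp (2 * (ρ + lam / 2 * t))))
        * Real.exp (-(2 * ρ))) atBot
      (𝓝 (2 * Real.pi * ((K + (levi (c (I * t, 0)) (0, a)).re) * Real.exp (lam * t)))) := by
    intro t ht
    have h1 := (((hw.tendsto_circleMean_sub hR hinv a ⟨ht.1, ht.2.trans_le hT⟩).comp (hlin t)).add_const
      (2 * Real.pi * K)).mul_const (Real.exp (lam * t))
    have e1 : (2 * Real.pi * (levi (c (I * t, 0)) (0, a)).re + 2 * Real.pi * K)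
        * Real.exp (lam * t)
        = 2 * Real.pi * ((K + (levi (c (I * t, 0)) (0, a)).re) * Real.exp (lam * t)) := by ring
    rw [e1] at h1
    refine h1.congr fun ρ => ?_
    have e2 : Real.exp (-(2 * (ρ + lam / 2 * t))) * Real.exp (lam * t) = Real.exp (-(2 * ρ)) := by
      rw [← Real.exp_add]; congr 1; ring
    have e3 : Real.exp (2 * (ρ + lam / 2 * t)) * Real.exp (-(2 * ρ)) = Real.exp (lam * t) := by
      rw [← Real.exp_add]; congr 1; ring
    simp only [Function.comp_apply, hn]
    rw [add_mul, add_mul, mul_assoc _ (Real.exp _), e2]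
    linear_combination (-(2 * Real.pi * K)) * e3
  have hlim' := ((hlim t₀ ht₀).const_mul p).add ((hlim t₁ ht₁).const_mul q)
  have hfin := le_of_tendsto_of_tendsto (hlim t htm) hlim' ?_
  · simp only [smul_eq_mul]
    have h2pi : 0 < 2 * Real.pi := by linarith [Real.pi_pos]
    refine le_of_mul_le_mul_left ?_ h2pi
    linarith
  obtain ⟨B, hB⟩ : ∃ B : ℝ, ∀ x ∈ Ioo 0 T, lam / 2 * x ≤ B :=
    ⟨|lam / 2|, fun x hx => by
      have : lam / 2 * x ≤ |lam / 2| * 1 :=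
        (mul_le_mul_of_nonneg_right (le_abs_self _) hx.1.le).trans
          (mul_le_mul_of_nonneg_left (hx.2.le.trans hT) (abs_nonneg _))
      simpa using this⟩
  -- For such $\rho$ every circle along the line stays in the ball of radius $R$.
  have hsmall : ∀ᶠ ρ in atBot, Real.exp (ρ + B) * ‖a‖ < R :=
    (hexp.comp (tendsto_atBot_add_const_right atBot B tendsto_id)).eventually (gt_mem_nhds hR)
  filter_upwards [hsmall] with ρ hρ
  have hx : ∀ x ∈ Icc (0 : ℝ) 1, t₀ + (t₁ - t₀) * x ∈ Ioo 0 T := by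
    intro x hx
    have := convex_Ioo 0 T ht₀ ht₁ (sub_nonneg.2 hx.2) hx.1 (by ring)
    convert this using 1
    simp only [smul_eq_mul]; ring
  have h := hw.convexOn_circleMean hinv a t₀ (ρ + lam / 2 * t₀) (t₁ - t₀)
    (lam / 2 * (t₁ - t₀)) K 0 isOpen_interior Subset.rfl
    (fun x hx' θ _ => ?_) (fun y hy μ => by simpa using hL y hy (t₁ - t₀) μ)
  · have h1 := h.2 (left_mem_Icc.2 zero_le_one) (right_mem_Icc.2 zero_le_one) hp hq hpq
    have e1 : t₀ + (t₁ - t₀) * q = t := by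
      rw [ht]
      simp only [smul_eq_mul]
      linear_combination (-t₀) * hpq
    have e2 : ρ + lam / 2 * t₀ + lam / 2 * (t₁ - t₀) * q = ρ + lam / 2 * t := by
      rw [← e1]; ring
    have e3 : ρ + lam / 2 * t₀ + lam / 2 * (t₁ - t₀) = ρ + lam / 2 * t₁ := by ring
    simp only [smul_eq_mul, mul_zero, mul_one, zero_add, add_zero, zero_mul, add_sub_cancel, e1,
      e2, e3] at h1
    -- Concavity of the axis values lets them be subtracted without losing convexity.
    have h2 : p * w (I * t₀, 0) + q * w (I * t₁, 0) ≤ w (I * t, 0) := haff.2 ht₀ ht₁ hp hq hpq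
    have hpi : 0 < 2 * Real.pi := by linarith [Real.pi_pos]
    have h3 := mul_le_mul_of_nonneg_left h2 hpi.le
    rw [← mul_assoc p, ← mul_assoc q, ← add_mul]
    refine mul_le_mul_of_nonneg_right ?_ (Real.exp_pos _).le
    simp only [hn]
    linarith
  · have htx := hx x hx'
    refine mem_interior_closedStrip_prod (by simpa [polarPoint] using htx.1)
      (by simpa [polarPoint] using htx.2.trans_le hT) ?_
    rw [norm_polarPoint_snd]
    refine lt_of_le_of_lt (mul_le_mul_of_nonneg_right (Real.exp_le_exp.2 ?_) (norm_nonneg a)) hρ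
    have := hB _ htx
    linarith

end Means

/-! ### Evenness in $z$ and the mixed coefficients. -/

/-- The reflection `(s, z) ↦ (s, -z)`. -/
noncomputable def reflection (m : ℕ) : (ℂ × (Fin m → ℂ)) ≃L[ℝ] (ℂ × (Fin m → ℂ)) :=
  (ContinuousLinearEquiv.refl ℝ ℂ).prodCongr (ContinuousLinearEquiv.neg ℝ)

@[simp] theorem reflection_apply (y : ℂ × (Fin m → ℂ)) : reflection m y = (y.1, -y.2) := rfl

theorem measurePreserving_reflection :
    MeasurePreserving (reflection m) (volume : Measure (ℂ × (Fin m → ℂ))) volume :=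
  (MeasurePreserving.id (volume : Measure ℂ)).prod
    (Measure.measurePreserving_neg (volume : Measure (Fin m → ℂ)))

theorem integral_comp_reflection (f : ℂ × (Fin m → ℂ) → ℂ) :
    ∫ y, f (reflection m y) = ∫ y, f y :=
  measurePreserving_reflection.integral_comp
    (reflection m).toHomeomorph.measurableEmbedding f

theorem wirtinger_wirtingerBar_comp_reflection (χ : ℂ × (Fin m → ℂ) → ℂ)
    (j : Fin m) (y : ℂ × (Fin m → ℂ)) :
    wirtinger (Sum.inl ()) (wirtingerBar (Sum.inr j) (χ ∘ reflection m)) y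
      = -wirtinger (Sum.inl ()) (wirtingerBar (Sum.inr j) χ) (reflection m y) := by
  have hl : ∀ c : ℂ, reflection m (coordVec (Sum.inl ()) c) = coordVec (Sum.inl ()) c := by
    intro c; ext <;> simp [coordVec]
  have hr : ∀ c : ℂ, reflection m (coordVec (Sum.inr j) c) = -coordVec (Sum.inr j) c := by
    intro c; ext <;> simp [coordVec]
  have h1 : wirtingerBar (Sum.inr j) (χ ∘ reflection m)
      = fun y => -(wirtingerBar (Sum.inr j) χ ∘ reflection m) y := by
    funext y
    simp only [wirtingerBar, Function.comp_apply, (reflection m).comp_right_fderiv,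
      ContinuousLinearMap.comp_apply, ContinuousLinearEquiv.coe_coe, hr, map_neg]
    ring
  rw [h1]
  simp only [wirtinger, fderiv_fun_neg, (reflection m).comp_right_fderiv, _root_.neg_apply,
    ContinuousLinearMap.comp_apply, ContinuousLinearEquiv.coe_coe, hl]
  ring

/-- If `w` is even in `z`, the mixed coefficients `∂²w/∂s∂\bar z_j` vanish for `z = 0`. -/
theorem HasDdbar.coeff_eq_zero_of_even {w : ℂ × (Fin m → ℂ) → ℝ}
    {c : ℂ × (Fin m → ℂ) → Matrix (Idx m) (Idx m) ℂ} {A : Set (ℂ × (Fin m → ℂ))}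
    (hw : HasDdbar w c A) (hA : ∀ y ∈ interior A, reflection m y ∈ interior A)
    (heven : ∀ y ∈ interior A, w (reflection m y) = w y) (j : Fin m) {s : ℂ}
    (hs : (s, 0) ∈ interior A) : c (s, 0) (Sum.inl ()) (Sum.inr j) = 0 := by
  set f : ℂ × (Fin m → ℂ) → ℂ := fun y => c y (Sum.inl ()) (Sum.inr j) with hf
  have hfc : ContinuousOn f (interior A) :=
    (continuous_id.matrix_elem _ _).comp_continuousOn (hw.continuousOn_coeff.mono interior_subset)
  have hfRc : ContinuousOn (fun y => f (reflection m y)) (interior A) :=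
    hfc.comp (reflection m).continuous.continuousOn hA
  -- The mixed derivative changes sign under reflection while $w$ does not, so $f+f\circ R=0$
  -- weakly, hence pointwise by continuity. At a fixed point of the reflection this reads $2f=0$.
  have hsum : ContinuousOn (fun y => f y + f (reflection m y)) (interior A) := hfc.add hfRc
  have hae := isOpen_interior.ae_eq_zero_of_integral_contDiff_smul_eq_zero (μ := volume)
    (hsum.locallyIntegrableOn isOpen_interior.measurableSet) ?_
  · have h0 : (fun y => f y + f (reflection m y)) =ᵐ[volume.restrict (interior A)] fun _ => 0 :=
      (ae_restrict_iff' isOpen_interior.measurableSet).2 hae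
    have h1 := Measure.eqOn_open_of_ae_eq h0 isOpen_interior hsum continuousOn_const hs
    have h2 : reflection m (s, 0) = (s, 0) := by simp
    simp only [h2] at h1
    exact (add_self_eq_zero.1 h1)
  intro g hg hgc hgs
  set χ : ℂ × (Fin m → ℂ) → ℂ := fun y => (g y : ℂ) with hχdef
  have hχ : ContDiff ℝ ∞ χ := ofRealCLM.contDiff.comp hg
  have hχc : HasCompactSupport χ := hgc.comp_left (g := fun r : ℝ => (r : ℂ)) (by simp)
  have hχs : tsupport χ ⊆ interior A := by
    refine (closure_mono ?_).trans hgs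
    intro y hy h0
    exact hy (by simp [hχdef, h0])
  have hRχ : ContDiff ℝ ∞ (χ ∘ reflection m) := hχ.comp (reflection m).contDiff
  have hRχc : HasCompactSupport (χ ∘ reflection m) :=
    hχc.comp_homeomorph (reflection m).toHomeomorph
  have hRR : ∀ y, reflection m (reflection m y) = y := fun y => by simp
  have hRχs : tsupport (χ ∘ reflection m) ⊆ interior A := by
    have h1 : tsupport (χ ∘ reflection m) ⊆ reflection m ⁻¹' tsupport χ :=
      closure_minimal (fun y hy => subset_tsupport χ hy)
        ((isClosed_tsupport χ).preimage (reflection m).continuous)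
    intro y hy
    rw [← hRR y]
    exact hA _ (hχs (h1 hy))
  have e1 := hw.weak χ hχ hχc hχs (Sum.inl ()) (Sum.inr j)
  have e2 := hw.weak (χ ∘ reflection m) hRχ hRχc hRχs (Sum.inl ()) (Sum.inr j)
  have e3 : ∫ y, f y * (χ ∘ reflection m) y = ∫ y, f (reflection m y) * χ y := by
    rw [← integral_comp_reflection]
    simp only [Function.comp_apply, hRR]
  have e4 : ∫ y, (w y : ℂ) * wirtinger (Sum.inl ())
        (wirtingerBar (Sum.inr j) (χ ∘ reflection m)) y
      = -∫ y, (w y : ℂ) * wirtinger (Sum.inl ()) (wirtingerBar (Sum.inr j) χ) y := by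
    rw [← integral_comp_reflection, ← integral_neg]
    refine integral_congr_ae (Eventually.of_forall fun y => ?_)
    simp only [wirtinger_wirtingerBar_comp_reflection, hRR]
    by_cases hy : y ∈ tsupport χ
    · rw [heven y (hχs hy)]
      ring
    · have : wirtinger (Sum.inl ()) (wirtingerBar (Sum.inr j) χ) y = 0 := by
        by_contra h
        exact hy (support_wirtinger_wirtingerBar χ _ _ h)
      simp [this]
  have i1 : Integrable fun y => f y * χ y :=
    integrable_mul_of_support_subset hχc (hfc.mono hχs) hχ.continuous.continuousOn
      (subset_tsupport χ)
  have i2 : Integrable fun y => f (reflection m y) * χ y :=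
    integrable_mul_of_support_subset hχc (hfRc.mono hχs) hχ.continuous.continuousOn
      (subset_tsupport χ)
  have e5 : ∀ y, g y • (f y + f (reflection m y)) = f y * χ y + f (reflection m y) * χ y := by
    intro y
    rw [real_smul]
    ring
  simp only [e5]
  rw [integral_add i1 i2, ← e3]
  change (∫ y, c y (Sum.inl ()) (Sum.inr j) * χ y)
    + ∫ y, c y (Sum.inl ()) (Sum.inr j) * (χ ∘ reflection m) y = 0
  rw [← e1, ← e2, e4, add_neg_cancel]

/-! ### The Kähler form in the chart and its contribution to the Levi form. -/

/-- The hermitian form of a real alternating form of type `(1,1)`. -/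
theorem sum_hermCoeff (α : (Fin m → ℂ) [⋀^Fin 2]→L[ℝ] ℝ)
    (hα : ∀ ξ η : Fin m → ℂ, α ![I • ξ, I • η] = α ![ξ, η]) (a : Fin m → ℂ) :
    ∑ j, ∑ k, hermCoeff α j k * (a j * star (a k)) = ((α ![a, I • a] / 2 : ℝ) : ℂ) := by
  have up0 : ∀ ξ η x : Fin m → ℂ, Function.update ![ξ, η] 0 x = ![x, η] := by
    intro ξ η x
    ext i
    fin_cases i <;> rfl
  have up1 : ∀ ξ η x : Fin m → ℂ, Function.update ![ξ, η] 1 x = ![ξ, x] := by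
    intro ξ η x
    ext i
    fin_cases i <;> rfl
  have hadd : ∀ ξ ξ' η, α ![ξ + ξ', η] = α ![ξ, η] + α ![ξ', η] := by
    intro ξ ξ' η
    have h := α.map_update_add ![ξ, η] 0 ξ ξ'
    rwa [up0, up0, up0] at h
  have hsmul : ∀ (r : ℝ) ξ η, α ![r • ξ, η] = r * α ![ξ, η] := by
    intro r ξ η
    have h := α.map_update_smul ![ξ, η] 0 r ξ
    rwa [up0, up0, smul_eq_mul] at h
  have hadd' : ∀ ξ η η', α ![ξ, η + η'] = α ![ξ, η] + α ![ξ, η'] := by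
    intro ξ η η'
    have h := α.map_update_add ![ξ, η] 1 η η'
    rwa [up1, up1, up1] at h
  have hsmul' : ∀ (r : ℝ) ξ η, α ![ξ, r • η] = r * α ![ξ, η] := by
    intro r ξ η
    have h := α.map_update_smul ![ξ, η] 1 r η
    rwa [up1, up1, smul_eq_mul] at h
  have hI : ∀ ξ η : Fin m → ℂ, α ![I • ξ, η] = -α ![ξ, I • η] := by
    intro ξ η
    have h := hα ξ (I • η)
    rw [show I • I • η = (-1 : ℝ) • η by rw [smul_smul, I_mul_I]; simp, hsmul'] at h
    linarith
  have hself : ∀ ξ, α ![ξ, ξ] = 0 := fun ξ =>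
    α.map_eq_zero_of_eq ![ξ, ξ] (i := 0) (j := 1) rfl (by decide)
  -- $H$ is linear in the first and antilinear in the second slot, which is where type $(1,1)$
  -- enters; expanding $H(a,a)$ in the standard basis gives the sum.
  let H : (Fin m → ℂ) → (Fin m → ℂ) → ℂ := fun ξ η =>
    ((α ![ξ, I • η] : ℂ) - I * (α ![ξ, η] : ℂ)) / 2
  have H1 : ∀ (z : ℂ) ξ η, H (z • ξ) η = z * H ξ η := by
    intro z ξ η
    have hz : z • ξ = z.re • ξ + z.im • (I • ξ) := by
      conv_lhs => rw [← re_add_im z]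
      rw [add_smul, mul_smul, coe_smul, coe_smul]
    have hII : α ![ξ, I • (I • η)] = -α ![ξ, η] := by
      rw [smul_smul, I_mul_I]
      simpa using hsmul' (-1) ξ η
    simp only [H, hz, hadd, hsmul, hI, hII]
    conv_rhs => rw [← re_add_im z]
    push_cast
    linear_combination (z.im * (α ![ξ, η] : ℂ) / 2) * I_sq
  have H2 : ∀ (z : ℂ) ξ η, H ξ (z • η) = star z * H ξ η := by
    intro z ξ η
    have hz : z • η = z.re • η + z.im • (I • η) := by
      conv_lhs => rw [← re_add_im z]
      rw [add_smul, mul_smul, coe_smul, coe_smul]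
    have hIz : I • (z.re • η + z.im • (I • η)) = z.re • (I • η) + (-z.im) • η := by
      rw [smul_add, smul_comm I, smul_comm I, smul_smul I I, I_mul_I]
      simp
    simp only [H, hz, hIz, hadd', hsmul']
    conv_rhs => rw [← re_add_im z]
    simp only [RCLike.star_def, map_add, map_mul, conj_ofReal, conj_I]
    push_cast
    linear_combination (-(z.im * (α ![ξ, η] : ℂ) / 2)) * I_sq
  have H3 : ∀ (b : Fin m → Fin m → ℂ) η, H (∑ j, b j) η = ∑ j, H (b j) η := by
    intro b η
    let L : (Fin m → ℂ) →+ ℂ :=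
      AddMonoidHom.mk' (fun ξ => H ξ η) fun ξ ξ' => by
        simp only [H, hadd]; push_cast; ring
    exact map_sum L b Finset.univ
  have H4 : ∀ (b : Fin m → Fin m → ℂ) ξ, H ξ (∑ j, b j) = ∑ j, H ξ (b j) := by
    intro b ξ
    let L : (Fin m → ℂ) →+ ℂ :=
      AddMonoidHom.mk' (fun η => H ξ η) fun η η' => by
        simp only [H, smul_add, hadd']; push_cast; ring
    exact map_sum L b Finset.univ
  have ha : a = ∑ j, a j • (Pi.single j 1 : Fin m → ℂ) := by
    ext i
    simp [Finset.sum_apply, Pi.single_apply]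
  have hH : H a a = ((α ![a, I • a] / 2 : ℝ) : ℂ) := by
    simp [H, hself]
  rw [← hH]
  conv_rhs => rw [ha]
  rw [H3]
  refine Finset.sum_congr rfl fun j _ => ?_
  rw [H4]
  refine Finset.sum_congr rfl fun k _ => ?_
  rw [H1, H2]
  have hk : (Pi.single k I : Fin m → ℂ) = I • Pi.single k 1 := by
    ext i
    simp [Pi.single_apply]
  simp only [hermCoeff, hk, H]
  ring

theorem levi_add (c d : Matrix (Idx m) (Idx m) ℂ) (ξ : ℂ × (Fin m → ℂ)) :
    levi (c + d) ξ = levi c ξ + levi d ξ := by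
  simp [-Fintype.sum_sum_type, levi, add_mul, Finset.sum_add_distrib]

theorem levi_fromBlocks (G : Matrix (Fin m) (Fin m) ℂ) (ξ : ℂ × (Fin m → ℂ)) :
    levi (Matrix.fromBlocks 0 0 0 G) ξ = ∑ j, ∑ k, G j k * (ξ.2 j * star (ξ.2 k)) := by
  simp [levi, dcoord]

theorem levi_nonneg_of_posSemidef {M : Matrix (Idx m) (Idx m) ℂ} (hM : M.PosSemidef)
    (ξ : ℂ × (Fin m → ℂ)) : 0 ≤ (levi M ξ).re := by
  -- The vector is conjugated because `levi` puts the conjugate on the column index.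
  have h := (Matrix.posSemidef_iff_dotProduct_mulVec.1 hM).2 fun p => star (dcoord p ξ)
  have e : levi M ξ = star (fun p => star (dcoord p ξ)) ⬝ᵥ M.mulVec fun p => star (dcoord p ξ) := by
    simp only [levi, dotProduct, Matrix.mulVec, Pi.star_apply, star_star, Finset.mul_sum]
    exact Finset.sum_congr rfl fun p _ => Finset.sum_congr rfl fun q _ => by ring
  rw [e]
  exact (Complex.le_def.1 h).1

section Manifold

variable {X : Type*} [TopologicalSpace X] [ChartedSpace (Fin m → ℂ) X]

theorem chartForm_apply (α : TwoForm m X) (e : OpenPartialHomeomorph X (Fin m → ℂ))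
    (y v w : Fin m → ℂ) : chartForm α e y ![v, w] = α (e.symm y)
      ![mfderiv 𝓘(ℂ, Fin m → ℂ) 𝓘(ℂ, Fin m → ℂ) e.symm y v,
        mfderiv 𝓘(ℂ, Fin m → ℂ) 𝓘(ℂ, Fin m → ℂ) e.symm y w] := by
  refine congrArg (α (e.symm y)) ?_
  ext i
  fin_cases i <;> rfl

theorem IsKaehlerForm.chartForm_type {α : TwoForm m X} (hα : IsKaehlerForm α)
    (e : OpenPartialHomeomorph X (Fin m → ℂ)) (y ξ η : Fin m → ℂ) :
    chartForm α e y ![I • ξ, I • η] = chartForm α e y ![ξ, η] := by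
  rw [chartForm_apply, chartForm_apply]
  exact (congrArg₂ (fun v w => α (e.symm y) ![v, w])
    (map_smul (mfderiv 𝓘(ℂ, Fin m → ℂ) 𝓘(ℂ, Fin m → ℂ) e.symm y) I ξ)
    (map_smul (mfderiv 𝓘(ℂ, Fin m → ℂ) 𝓘(ℂ, Fin m → ℂ) e.symm y) I η)).trans
    (hα.type_one_one (e.symm y) _ _)

theorem IsKaehlerForm.chartForm_pos [IsManifold 𝓘(ℂ, Fin m → ℂ) ω X] {α : TwoForm m X}
    (hα : IsKaehlerForm α) {e : OpenPartialHomeomorph X (Fin m → ℂ)}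
    (he : e ∈ IsManifold.maximalAtlas 𝓘(ℂ, Fin m → ℂ) ω X) {y : Fin m → ℂ} (hy : y ∈ e.target)
    {ξ : Fin m → ℂ} (hξ : ξ ≠ 0) : 0 < chartForm α e y ![ξ, I • ξ] := by
  have hd : e.MDifferentiable 𝓘(ℂ, Fin m → ℂ) 𝓘(ℂ, Fin m → ℂ) :=
    ⟨(contMDiffOn_of_mem_maximalAtlas he).mdifferentiableOn (by simp),
      (contMDiffOn_symm_of_mem_maximalAtlas he).mdifferentiableOn (by simp)⟩
  have hinj : Function.Injective
      (mfderiv 𝓘(ℂ, Fin m → ℂ) 𝓘(ℂ, Fin m → ℂ) e.symm y) := hd.symm.mfderiv_injective hy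
  have hne : mfderiv 𝓘(ℂ, Fin m → ℂ) 𝓘(ℂ, Fin m → ℂ) e.symm y ξ ≠ 0 := by
    intro h0
    exact hξ (hinj (h0.trans (map_zero _).symm))
  have h := hα.pos (e.symm y) _ hne
  rw [chartForm_apply]
  exact h.trans_eq (congrArg (fun v => α (e.symm y)
    ![mfderiv 𝓘(ℂ, Fin m → ℂ) 𝓘(ℂ, Fin m → ℂ) e.symm y ξ, v])
    (map_smul (mfderiv 𝓘(ℂ, Fin m → ℂ) 𝓘(ℂ, Fin m → ℂ) e.symm y) I ξ).symm)

theorem IsKaehlerForm.continuousOn_chartForm {α : TwoForm m X}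
    (hα : IsKaehlerForm α) {e : OpenPartialHomeomorph X (Fin m → ℂ)}
    (he : e ∈ IsManifold.maximalAtlas 𝓘(ℂ, Fin m → ℂ) ω X) (a b : Fin m → ℂ) :
    ContinuousOn (fun y => chartForm α e y ![a, b]) e.target :=
  (continuous_eval_const _).comp_continuousOn (hα.smooth e he).continuousOn

theorem levi_totalCoeff {α : TwoForm m X} (hα : IsKaehlerForm α)
    (φ : OpenPartialHomeomorph X (Fin m → ℂ))
    (c : ℂ × (Fin m → ℂ) → Matrix (Idx m) (Idx m) ℂ) (y : ℂ × (Fin m → ℂ)) (s : ℂ) (μ : ℂ)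
    (a : Fin m → ℂ) :
    (levi (totalCoeff α φ c y) (s, μ • a)).re
      = ‖μ‖ ^ 2 * (chartForm α φ y.2 ![a, I • a] / 2) + (levi (c y) (s, μ • a)).re := by
  have h : levi (Matrix.fromBlocks 0 0 0 (hermCoeff (chartForm α φ y.2))) (s, μ • a)
      = ((‖μ‖ ^ 2 : ℝ) : ℂ) * ((chartForm α φ y.2 ![a, I • a] / 2 : ℝ) : ℂ) := by
    rw [levi_fromBlocks, ← sum_hermCoeff _ (hα.chartForm_type φ y.2)]
    have hμ : ((‖μ‖ ^ 2 : ℝ) : ℂ) = μ * star μ := by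
      rw [RCLike.star_def, mul_conj, normSq_eq_norm_sq]
    simp only [hμ, Finset.mul_sum, Pi.smul_apply, smul_eq_mul, star_mul']
    exact Finset.sum_congr rfl fun p _ => Finset.sum_congr rfl fun q _ => by ring
  rw [totalCoeff, levi_add, h, add_re, re_ofReal_mul, ofReal_re]

end Manifold

/-! ### Nondegeneracy and affinity along a leaf. -/

section Means

variable {w : ℂ × (Fin m → ℂ) → ℝ} {c : ℂ × (Fin m → ℂ) → Matrix (Idx m) (Idx m) ℂ} {R : ℝ}

theorem HasDdbar.concaveOn_axis
    (hw : HasDdbar w c (closedStrip ×ˢ Metric.closedBall 0 R)) (hR : 0 < R)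
    (hinv : ∀ s ∈ closedStrip, ∀ z ∈ Metric.closedBall (0 : Fin m → ℂ) R, ∀ σ : ℝ,
      w (s + σ, z) = w (s, z))
    {T : ℝ} (hT : T ≤ 1) (h0 : ∀ t ∈ Ioo 0 T, (levi (c (I * t, 0)) (1, 0)).re = 0) :
    ConcaveOn ℝ (Ioo 0 T) fun t : ℝ => w (I * t, 0) := by
  have h := hw.neg.convexOn_axis hR (fun s hs z hz σ => by rw [hinv s hs z hz σ]) hT
    (fun t ht => by rw [levi_neg, neg_re, h0 t ht, neg_zero])
  exact neg_convexOn_iff.1 h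

theorem HasDdbar.continuousOn_axis
    (hw : HasDdbar w c (closedStrip ×ˢ Metric.closedBall (0 : Fin m → ℂ) R)) (hR : 0 < R) :
    ContinuousOn (fun t : ℝ => w (I * t, 0)) (Icc 0 1) :=
  hw.continuousOn.comp continuous_axis.continuousOn fun _ ht => axis_mem hR.le ht

theorem HasDdbar.continuousOn_levi_axis
    (hw : HasDdbar w c (closedStrip ×ˢ Metric.closedBall (0 : Fin m → ℂ) R)) (hR : 0 < R)
    (ξ : ℂ × (Fin m → ℂ)) :
    ContinuousOn (fun t : ℝ => (levi (c (I * t, 0)) ξ).re) (Icc 0 1) :=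
  (continuous_re.comp (continuous_levi ξ)).comp_continuousOn
    (hw.continuousOn_coeff.comp continuous_axis.continuousOn fun _ ht => axis_mem hR.le ht)

/-- As long as the axis is a leaf, the fiberwise Levi form of `ω + i∂∂bar w` along the axis cannot
degenerate. -/
theorem HasDdbar.levi_axis_pos
    (hw : HasDdbar w c (closedStrip ×ˢ Metric.closedBall 0 R)) (hR : 0 < R)
    (hinv : ∀ s ∈ closedStrip, ∀ z ∈ Metric.closedBall (0 : Fin m → ℂ) R, ∀ σ : ℝ,
      w (s + σ, z) = w (s, z))
    (h0 : ∀ z ∈ Metric.closedBall (0 : Fin m → ℂ) R, w (0, z) = 0)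
    (a : Fin m → ℂ) {g : (Fin m → ℂ) → ℝ} (hg : ContinuousAt g 0) (hg0 : 0 < g 0)
    (hL : ∀ y ∈ closedStrip ×ˢ Metric.closedBall (0 : Fin m → ℂ) R, ∀ (α : ℝ) (μ : ℂ),
      0 ≤ ‖μ‖ ^ 2 * g y.2 + (levi (c y) ((α : ℂ), μ • a)).re)
    {T : ℝ} (hT : T ∈ Icc (0 : ℝ) 1)
    (hleaf : ∀ t ∈ Ioo 0 T, (levi (c (I * t, 0)) (1, 0)).re = 0) :
    0 < g 0 + (levi (c (I * T, 0)) (0, a)).re := by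
  have hzero : (levi (c (I * (0 : ℝ), 0)) (0, a)).re = 0 := by
    simpa [Prod.mk_zero_zero] using hw.levi_eq_zero_of_boundary hR hinv h0 a
  rcases hT.1.eq_or_lt with rfl | hT0
  · rw [hzero, add_zero]
    exact hg0
  by_contra! hneg
  set h : ℝ → ℝ := fun t => g 0 + (levi (c (I * t, 0)) (0, a)).re with hh
  have hcont : ContinuousOn h (Icc 0 T) :=
    continuousOn_const.add ((hw.continuousOn_levi_axis hR _).mono (Icc_subset_Icc_right hT.2))
  have hconv : ∀ lam : ℝ, ConvexOn ℝ (Ioo 0 T) fun t => h t * Real.exp (lam * t) := by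
    intro lam
    refine ⟨convex_Ioo _ _, fun t₀ ht₀ t₁ ht₁ p q hp hq hpq => ?_⟩
    -- A constant $K>g(0)$ dominates $g$ only on a smaller ball. Shrinking the ball is harmless, as
    -- the conclusion concerns the axis alone, and afterwards $K\to g(0)$.
    have hK : ∀ᶠ K in 𝓝[>] (g 0), ConvexOn ℝ (Ioo 0 T) fun t : ℝ =>
        (K + (levi (c (I * t, 0)) (0, a)).re) * Real.exp (lam * t) := by
      filter_upwards [self_mem_nhdsWithin] with K hK
      obtain ⟨r, hr, hball⟩ := Metric.eventually_nhds_iff_ball.1 (hg.eventually (gt_mem_nhds hK))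
      have hr' : 0 < min R (r / 2) := lt_min hR (by positivity)
      have hsub : Metric.closedBall (0 : Fin m → ℂ) (min R (r / 2)) ⊆ Metric.closedBall 0 R :=
        Metric.closedBall_subset_closedBall (min_le_left _ _)
      refine (hw.mono (prod_mono_right hsub)).convexOn_levi_mul_exp hr'
        (fun s hs z hz σ => hinv s hs z (hsub hz) σ) hT.2 (hw.concaveOn_axis hR hinv hT.2 hleaf) a K
        (fun y hy α μ => ?_) lam
      have hy' := interior_subset hy
      have h1 := hL y ⟨hy'.1, hsub hy'.2⟩ α μ
      have h2 : g y.2 < K := by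
        refine hball _ (Metric.closedBall_subset_ball ?_ hy'.2)
        exact (min_le_right _ _).trans_lt (by linarith)
      nlinarith [mul_le_mul_of_nonneg_left h2.le (sq_nonneg ‖μ‖)]
    have hlim : ∀ t : ℝ, Tendsto
        (fun K => (K + (levi (c (I * t, 0)) (0, a)).re) * Real.exp (lam * t)) (𝓝[>] (g 0))
        (𝓝 (h t * Real.exp (lam * t))) := fun t =>
      ((tendsto_id.mono_left nhdsWithin_le_nhds).add_const _).mul_const _
    exact le_of_tendsto_of_tendsto (hlim _) (((hlim t₀).const_smul p).add ((hlim t₁).const_smul q))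
      (hK.mono fun K hK => hK.2 ht₀ ht₁ hp hq hpq)
  have := nonpos_of_convexOn_mul_exp hT0 hcont
    (fun lam => convexOn_Icc_of_convexOn_Ioo hT0 (hcont.mul (by fun_prop)) (hconv lam)) hneg
  simp only [hh, hzero, add_zero] at this
  linarith

/-- If the `ds ∧ d\bar s` coefficient vanishes along the axis, `w` is affine along it. -/
theorem HasDdbar.eq_mul_of_leaf
    (hw : HasDdbar w c (closedStrip ×ˢ Metric.closedBall 0 R)) (hR : 0 < R)
    (hinv : ∀ s ∈ closedStrip, ∀ z ∈ Metric.closedBall (0 : Fin m → ℂ) R, ∀ σ : ℝ,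
      w (s + σ, z) = w (s, z)) (h0 : w (0, 0) = 0)
    (hleaf : ∀ t ∈ Ioo (0 : ℝ) 1, (levi (c (I * t, 0)) (1, 0)).re = 0)
    {t : ℝ} (ht : t ∈ Icc (0 : ℝ) 1) : w (I * t, 0) = w (I, 0) * t := by
  have hc := hw.continuousOn_axis hR
  have h1 := convexOn_Icc_of_convexOn_Ioo one_pos hc (hw.convexOn_axis hR hinv le_rfl hleaf)
  have h2 := convexOn_Icc_of_convexOn_Ioo one_pos hc.neg
    (hw.concaveOn_axis hR hinv le_rfl hleaf).neg
  have e1 := h1.2 (left_mem_Icc.2 zero_le_one) (right_mem_Icc.2 zero_le_one) (sub_nonneg.2 ht.2)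
    ht.1 (by ring)
  have e2 := h2.2 (left_mem_Icc.2 zero_le_one) (right_mem_Icc.2 zero_le_one) (sub_nonneg.2 ht.2)
    ht.1 (by ring)
  simp only [smul_eq_mul, mul_zero, mul_one, zero_add, ofReal_zero, ofReal_one, h0,
    Pi.neg_apply, neg_zero] at e1 e2
  linarith

end Means

/-! ### The coefficient matrix in block form. -/

theorem levi_inl (c : Matrix (Idx m) (Idx m) ℂ) :
    levi c (1, 0) = c (Sum.inl ()) (Sum.inl ()) := by
  simp [levi, dcoord]

theorem levi_inr (c : Matrix (Idx m) (Idx m) ℂ) (a : Fin m → ℂ) :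
    levi c (0, a) = a ⬝ᵥ c.toBlocks₂₂.mulVec (star a) := by
  simp only [levi, dcoord, dotProduct, Matrix.mulVec, Matrix.toBlocks₂₂, Fintype.sum_sum_type,
    Finset.mul_sum]
  simp only [Sum.elim_inl, Sum.elim_inr, LinearMap.fst_apply, LinearMap.comp_apply,
    LinearMap.snd_apply, LinearMap.proj_apply, zero_mul, mul_zero, star_zero,
    Finset.sum_const_zero, zero_add, Matrix.of_apply, Pi.star_apply]
  exact Finset.sum_congr rfl fun p _ => Finset.sum_congr rfl fun q _ => by ring

theorem det_eq_of_toBlocks₁₂_eq_zero {M : Matrix (Idx m) (Idx m) ℂ}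
    (h : ∀ j, M (Sum.inl ()) (Sum.inr j) = 0) :
    M.det = M (Sum.inl ()) (Sum.inl ()) * M.toBlocks₂₂.det := by
  have h12 : M.toBlocks₁₂ = 0 := by
    ext i j
    exact h j
  conv_lhs => rw [← Matrix.fromBlocks_toBlocks M, h12, Matrix.det_fromBlocks_zero₁₂]
  congr 1
  exact Matrix.det_unique _

theorem exists_levi_eq_zero_of_det_eq_zero {M : Matrix (Idx m) (Idx m) ℂ}
    (h : M.toBlocks₂₂.det = 0) : ∃ a : Fin m → ℂ, a ≠ 0 ∧ levi M (0, a) = 0 := by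
  obtain ⟨v, hv, hMv⟩ := Matrix.exists_mulVec_eq_zero_iff.2 h
  refine ⟨star v, star_ne_zero.2 hv, ?_⟩
  rw [levi_inr, star_star, hMv, dotProduct_zero]

end WeakGeodesic

/-! ### The axis is a leaf on the whole interval. -/

open WeakGeodesic in
theorem proposition3p1 {m : ℕ} (hm : 0 < m)
    {X : Type*} [TopologicalSpace X] [T2Space X] [CompactSpace X] [ConnectedSpace X]
    [ChartedSpace (Fin m → ℂ) X] [IsManifold 𝓘(ℂ, Fin m → ℂ) ω X]
    (ω₀ : WeakGeodesic.TwoForm m X) (hω₀ : WeakGeodesic.IsKaehlerForm ω₀)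
    (g : X → X) (hg : WeakGeodesic.IsHolomorphicIsometry ω₀ g) (hgg : ∀ x, g (g x) = x)
    (x₀ : X) (hx₀ : g x₀ = x₀) (hiso : ∀ᶠ x in nhdsWithin x₀ {x₀}ᶜ, g x ≠ x)
    (φ : OpenPartialHomeomorph X (Fin m → ℂ))
    (hφ : φ ∈ IsManifold.maximalAtlas 𝓘(ℂ, Fin m → ℂ) ω X)
    (hφx₀ : x₀ ∈ φ.source)
    (hφg : ∀ x ∈ φ.source, g x ∈ φ.source ∧ φ (g x) = -φ x)
    (v : X → ℝ) (u : ℂ → X → ℝ) (hu : WeakGeodesic.IsPshSolution ω₀ φ v u)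
    (hug : ∀ s ∈ WeakGeodesic.closedStrip, ∀ x ∈ φ.source, u s (g x) = u s x) :
    ∃ a : ℝ, ∀ s ∈ WeakGeodesic.closedStrip, u s x₀ = a * s.im := by
  have hφ0 : φ x₀ = 0 := by
    have h := (hφg x₀ hφx₀).2
    rw [hx₀] at h
    exact self_eq_neg.1 h
  have h0t : (0 : Fin m → ℂ) ∈ φ.target := hφ0 ▸ φ.map_source hφx₀
  have hsymm0 : φ.symm 0 = x₀ := by rw [← hφ0, φ.left_inv hφx₀]
  obtain ⟨R, hR, hRt⟩ := Metric.nhds_basis_closedBall.mem_iff.1 (φ.open_target.mem_nhds h0t)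
  obtain ⟨c, hc, hpsh⟩ := hu.exists_ddbar
  set w : ℂ × (Fin m → ℂ) → ℝ := fun y => u y.1 (φ.symm y.2) with hwdef
  have hw : HasDdbar w c (closedStrip ×ˢ Metric.closedBall 0 R) :=
    hc.mono (Set.prod_mono_right hRt)
  have hinv : ∀ s ∈ closedStrip, ∀ z ∈ Metric.closedBall (0 : Fin m → ℂ) R, ∀ σ : ℝ,
      w (s + σ, z) = w (s, z) := fun s hs z hz σ =>
    hu.translation s hs _ (φ.map_target (hRt hz)) σ
  have hw0 : ∀ z ∈ Metric.closedBall (0 : Fin m → ℂ) R, w (0, z) = 0 := fun z hz =>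
    hu.boundary_zero 0 (by simp) _ (φ.map_target (hRt hz))
  have hint : ∀ y ∈ interior (closedStrip ×ˢ Metric.closedBall (0 : Fin m → ℂ) R),
      reflection m y ∈ interior (closedStrip ×ˢ Metric.closedBall (0 : Fin m → ℂ) R) := by
    intro y hy
    rw [interior_prod_eq, interior_closedBall _ hR.ne'] at hy ⊢
    exact ⟨hy.1, by simpa using hy.2⟩
  have heven : ∀ y ∈ interior (closedStrip ×ˢ Metric.closedBall (0 : Fin m → ℂ) R),
      w (reflection m y) = w y := by
    intro y hy
    have hy' := interior_subset hy
    have hs := φ.map_target (hRt hy'.2)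
    have h1 := hφg _ hs
    rw [φ.right_inv (hRt hy'.2)] at h1
    have h2 : φ.symm (-y.2) = g (φ.symm y.2) := by rw [← h1.2, φ.left_inv h1.1]
    simp only [hwdef, reflection_apply, h2]
    exact hug _ hy'.1 _ hs
  have haxis : ∀ t ∈ Set.Icc (0 : ℝ) 1, (((I * t : ℂ), 0) : ℂ × (Fin m → ℂ))
      ∈ closedStrip ×ˢ φ.target := fun t ht =>
    Set.prod_mono_right hRt (axis_mem hR.le ht)
  set D : ℝ → ℂ := fun t => (totalCoeff ω₀ φ c (I * t, 0)).toBlocks₂₂.det with hD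
  have hmixed : ∀ t ∈ Set.Ioo (0 : ℝ) 1, ∀ j,
      c (I * t, 0) (Sum.inl ()) (Sum.inr j) = 0 := fun t ht j =>
    hw.coeff_eq_zero_of_even hint heven j (mem_interior_closedStrip_prod (by simpa using ht.1)
      (by simpa using ht.2) (by simpa using hR))
  have hleaf : ∀ t ∈ Set.Ioo (0 : ℝ) 1, D t ≠ 0 → (levi (c (I * t, 0)) (1, 0)).re = 0 := by
    intro t ht hDt
    have h1 := det_eq_zero_of_oneOneForm_pow_eq_zero (hpsh _ (haxis t ⟨ht.1.le, ht.2.le⟩)).2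
    rw [det_eq_of_toBlocks₁₂_eq_zero fun j => by simp [totalCoeff, hmixed t ht j]] at h1
    have h2 := (mul_eq_zero.1 h1).resolve_right hDt
    rw [levi_inl]
    simpa [totalCoeff] using congrArg Complex.re h2
  have hDc : ContinuousOn D (Set.Icc 0 1) := by
    have hcc : ContinuousOn (fun t : ℝ => c (I * t, 0)) (Set.Icc 0 1) :=
      hw.continuousOn_coeff.comp continuous_axis.continuousOn fun t ht => axis_mem hR.le ht
    have h1 : Continuous fun M : Matrix (Idx m) (Idx m) ℂ =>
        (Matrix.fromBlocks 0 0 0 (hermCoeff (chartForm ω₀ φ 0)) + M).toBlocks₂₂.det := by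
      refine Continuous.matrix_det (continuous_matrix fun i j => ?_)
      exact continuous_const.add (continuous_id.matrix_elem _ _)
    exact h1.comp_continuousOn hcc
  have hDne : ∀ t ∈ Set.Icc (0 : ℝ) 1, D t ≠ 0 := by
    by_contra! hex
    have hZ : IsCompact (Set.Icc (0 : ℝ) 1 ∩ D ⁻¹' {0}) :=
      isCompact_Icc.of_isClosed_subset (hDc.preimage_isClosed_of_isClosed isClosed_Icc
        isClosed_singleton) Set.inter_subset_left
    -- Before the first zero $T$ of $D$ the axis is a leaf, so positivity propagates up to $T$ and
    -- contradicts the null vector of the fiber block there.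
    obtain ⟨T, hT, hTmin⟩ := hZ.exists_isLeast (hex.imp fun t ht => ⟨ht.1, ht.2⟩)
    obtain ⟨a, ha, hMa⟩ := exists_levi_eq_zero_of_det_eq_zero (Set.mem_singleton_iff.1 hT.2)
    have hsplit := levi_totalCoeff hω₀ φ c (I * T, 0) 0 1 a
    rw [one_smul, hMa] at hsplit
    have hpos := hw.levi_axis_pos hR hinv hw0 a
      (g := fun z => chartForm ω₀ φ z ![a, I • a] / 2)
      (((hω₀.continuousOn_chartForm hφ a (I • a)).continuousAt
        (φ.open_target.mem_nhds h0t)).div_const 2)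
      (by have := hω₀.chartForm_pos hφ h0t ha; positivity)
      (fun y hy α μ => by
        rw [← levi_totalCoeff hω₀]
        exact levi_nonneg_of_posSemidef (hpsh y (Set.prod_mono_right hRt hy)).1 _)
      hT.1 (fun t ht => hleaf t ⟨ht.1, ht.2.trans_le hT.1.2⟩ fun h0 =>
        (hTmin ⟨⟨ht.1.le, ht.2.le.trans hT.1.2⟩, h0⟩).not_gt ht.2)
    simp at hsplit
    linarith
  refine ⟨w (I, 0), fun s hs => ?_⟩
  have h1 := hw.eq_mul_of_leaf hR hinv (hw0 0 (by simpa using hR.le))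
    (fun t ht => hleaf t ht (hDne t ⟨ht.1.le, ht.2.le⟩)) (t := s.im) hs
  rw [← h1]
  -- Translation by $\operatorname{Re}s$ carries $i\operatorname{Im}s$ to $s$.
  have h2 := hinv (I * s.im) (axis_mem (m := m) hR.le hs).1 0 (by simpa using hR.le) s.re
  rw [← h2, hwdef]
  simp only [hsymm0]
  congr 1
  rw [add_comm, mul_comm, re_add_im]
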